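/- **Setting.** A vocabulary is a finite set of function symbols, each with an arity and markings: it is dynamic, intrinsic (static, built in) or extrinsic (static, an oracle), and it may be relational or numerical. Besides, every vocabulary contains the logic symbols $=$, true, false, nil, the Boolean connectives and if-then-else. Structures have basic functions that may be partial; all of them contain the same three distinct logic elements true, false, nil. Defined values of relational (numerical) symbols are Boolean (natural numbers). The default value is false for relational symbols, $0$ for numerical ones, and nil otherwise. Rules are built from assignments $f(t_1,\dots,t_k):=t_0$ with $f$ dynamic by "if $\beta$ then $R_1$ else $R_2$" with a Boolean term $\beta$ and by parallel composition; in if-then-else terms only the relevant branch is evaluated. A step fails if a function is evaluated where it is undefined, if contradictory updates are produced, or if the result would not be a structure. An algorithm (sequential abstract state machine) $A$ computing an $r$-ary function has a program, which is a rule, $r$ input variables and one output variable (different nullary dynamic symbols), and a nonempty set of admissible inputs $x\in|A|^r$. Up to isomorphism, its initial states have the base set $|A|$ and differ only in the values of the input variables, which range over the admissible inputs; all other dynamic functions have only default values initially. The objective function $F_A$ is the partial function on the admissible inputs with $F_A(x)=y$ if the computation on $x$ reaches a state which the program leaves unchanged and in which the output variable has the value $y$; $F_A(x)$ is undefined if there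 is no such state. The datastructure of $A$ is the set $|A|$ with the intrinsic functions of $A$. Natural-numbers arithmetic consists of the natural numbers and the logic elements, with zero, successor, predecessor and the characteristic function of the sort of numbers. An algorithm is numerical if all its states incorporate natural-numbers arithmetic. Structures are consistent if joint symbols have the same arity and markings and agree on tuples of joint elements. The union of pairwise consistent structures $D_i$ has as vocabulary and base set the unions of those of the $D_i$; a symbol of $D_i$ is interpreted as in $D_i$ on tuples from $D_i$, and takes its default value at tuples that lie in no $D_i$ having that symbol. **Theorem (Pruning Theorem).** Let $N\ge 1$ and let $A_0,\dots,A_{N-1}$ be algorithms whose datastructures are pairwise consistent, and consistent with (a copy of) natural-numbers arithmetic. Suppose that every extrinsic function $e$ of every $A_i$ is the objective function of some $A_j$, $j=j(i,e)$, in the following sense: $e$ has the arity of $F_{A_j}$; for every admissible input $x$ of $A_j$ with components in $|A_i|$, $e(x)$ and $F_{A_j}(x)$ are either both undefined or both defined and equal; and in its computations on admissible inputs $A_i$ queries $e$ only at admissible inputs of $A_j$. Suppose moreover that, as usual for mutual recursion, terminating computations do not rest on an infinite regress: say that $(i,x)$ calls $(j,x')$ if the computation of $A_i$ on the input $x$ poses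 a query $e(x')$ to an extrinsic function $e$ of $A_i$ with $j(i,e)=j$; whenever $F_{A_0}(x)$ is defined, there is no infinite sequence of calls starting with $(0,x)$. Then there is a numerical algorithm $B$, with no extrinsic functions, such that 1. the datastructure of $B$ is the union of the $N$ datastructures of the algorithms $A_i$ and natural-numbers arithmetic; 2. $B$ computes the objective function of $A_0$: $B$ has the same admissible inputs as $A_0$, and $F_B(x)$ and $F_{A_0}(x)$ are, for each of them, both undefined or both defined and equal. -/

import Mathlib

namespace SeqASM

universe u v

/-! ## Vocabularies -/

/-- A static symbol is either intrinsic (a built-in function of the datastructure) or extrinsic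
(provided by the outside world); all other symbols are dynamic. -/
inductive Status
  | dynamic
  | intrinsic
  | extrinsic

/-- A symbol may be marked relational or numerical. -/
inductive Kind
  | general
  | relational
  | numerical

/-- Arity and markings of a function symbol. -/
@[ext] structure Mark where
  arity : ℕ
  status : Status
  kind : Kind

/-- A (nonlogic) vocabulary: finitely many symbols taken from `S`, each with its arity and markings.
The logic symbols belong to every vocabulary; they are constructors of `Term` below. -/
@[ext] structure Vocabulary (S : Type v) where
  mark : S → Option Mark
  finite : {f | mark f ≠ none}.Finite

/-! ## Structures -/

/-- The ambient collection of elements: the three logic elements, the natural numbers, and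
arbitrary further elements. Base sets of structures are subsets of it, so that different
structures have the same logic elements and may share other elements. -/
inductive Elem (α : Type u)
  | tt
  | ff
  | nil
  | num (n : ℕ)
  | atom (a : α)

/-- The values that a basic function of the given kind may take. -/
def Kind.Allows {α : Type u} : Kind → Elem α → Prop
  | .general, _ => True
  | .relational, a => a = .tt ∨ a = .ff
  | .numerical, a => ∃ n, a = .num n

/-- The default value: `false` for relations, `0` for numerical functions, `nil` otherwise. -/
def Kind.dflt {α : Type u} : Kind → Elem α
  | .general => .nil
  | .relational => .ff
  | .numerical => .num 0

/-- A first-order structure with possibly partial basic functions: `fn f n xs` is the value of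
`f` at the `n`-tuple `xs`, and `none` if there is no such value. -/
@[ext] structure Struct (S : Type v) (α : Type u) where
  voc : Vocabulary S
  base : Set (Elem α)
  fn : S → (n : ℕ) → (Fin n → Elem α) → Option (Elem α)
  tt_mem : .tt ∈ base
  ff_mem : .ff ∈ base
  nil_mem : .nil ∈ base
  dflt_mem : ∀ f m, voc.mark f = some m → m.kind.dflt ∈ base
  fn_mem : ∀ f n xs y, fn f n xs = some y →
    ∃ m, voc.mark f = some m ∧ m.arity = n ∧ m.kind.Allows y ∧ (∀ k, xs k ∈ base) ∧ y ∈ base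

variable {S : Type v} {α : Type u}

/-- Consistency of structures: joint symbols have the same arity and markings, and they have the
same value (or are both undefined) at tuples of joint elements. -/
def Struct.Consistent (X Y : Struct S α) : Prop :=
  ∀ f mX mY, X.voc.mark f = some mX → Y.voc.mark f = some mY →
    mX = mY ∧ ∀ n (xs : Fin n → Elem α), (∀ k, xs k ∈ X.base ∧ xs k ∈ Y.base) →
      X.fn f n xs = Y.fn f n xs

/-- `X` is the union of the structures `D i`. For pairwise consistent structures this determines
`X`: its vocabulary and its base set are the unions, a function symbol of `D i` is interpreted as
in `D i` on tuples from `D i`, and it has its default value on all the other tuples. -/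
structure IsUnion {ι : Type*} (D : ι → Struct S α) (X : Struct S α) : Prop where
  voc : ∀ f m, X.voc.mark f = some m ↔ ∃ i, (D i).voc.mark f = some m
  base : X.base = ⋃ i, (D i).base
  fn_inside : ∀ i f m, (D i).voc.mark f = some m → ∀ xs : Fin m.arity → Elem α,
    (∀ k, xs k ∈ (D i).base) → X.fn f m.arity xs = (D i).fn f m.arity xs
  fn_outside : ∀ f m, X.voc.mark f = some m → ∀ xs : Fin m.arity → Elem α,
    (∀ k, xs k ∈ X.base) →
    (∀ i, (D i).voc.mark f = some m → ∃ k, xs k ∉ (D i).base) →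
    X.fn f m.arity xs = some m.kind.dflt

/-- `X` incorporates `Y`: it has all symbols and elements of `Y`, and on the elements of `Y` the
symbols of `Y` mean the same in `X` as in `Y`. -/
structure Struct.Incorporates (X Y : Struct S α) : Prop where
  voc : ∀ f m, Y.voc.mark f = some m → X.voc.mark f = some m
  base : Y.base ⊆ X.base
  fn : ∀ f m, Y.voc.mark f = some m → ∀ xs : Fin m.arity → Elem α,
    (∀ k, xs k ∈ Y.base) → X.fn f m.arity xs = Y.fn f m.arity xs

/-! ## Natural-numbers arithmetic -/

/-- Names for the operations of natural-numbers arithmetic and for its sort. -/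
structure ArithNames (S : Type v) where
  zero : S
  succ : S
  pred : S
  isNat : S
  distinct : [zero, succ, pred, isNat].Nodup

/-- The successor of a number; the default value `0` elsewhere. -/
def Elem.succ : Elem α → Elem α
  | .num n => .num (n + 1)
  | _ => .num 0

/-- The predecessor of a number, with predecessor `0` of `0`; the default value `0` elsewhere. -/
def Elem.pred : Elem α → Elem α
  | .num n => .num (n - 1)
  | _ => .num 0

/-- The characteristic function of the sort of natural numbers. -/
def Elem.isNat : Elem α → Elem α
  | .num _ => .tt
  | _ => .ff

open Classical in
/-- The vocabulary of arithmetic: zero, successor, predecessor and the sort of numbers. -/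
noncomputable def ArithNames.voc (c : ArithNames S) : Vocabulary S where
  mark f :=
    if f = c.zero then some ⟨0, .intrinsic, .numerical⟩
    else if f = c.succ then some ⟨1, .intrinsic, .numerical⟩
    else if f = c.pred then some ⟨1, .intrinsic, .numerical⟩
    else if f = c.isNat then some ⟨1, .intrinsic, .relational⟩
    else none
  finite := by
    refine Set.Finite.subset (Set.toFinite {c.zero, c.succ, c.pred, c.isNat}) ?_
    intro f hf
    by_contra h
    simp only [Set.mem_insert_iff, Set.mem_singleton_iff, not_or] at h
    simp [h] at hf

open Classical in
/-- The basic functions of arithmetic, on the numbers and the logic elements. -/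
noncomputable def ArithNames.fn (c : ArithNames S) (f : S) :
    (n : ℕ) → (Fin n → Elem α) → Option (Elem α)
  | 0, _ => if f = c.zero then some (.num 0) else none
  | 1, xs =>
    if ∃ a, xs 0 = .atom a then none
    else if f = c.succ then some (xs 0).succ
    else if f = c.pred then some (xs 0).pred
    else if f = c.isNat then some (xs 0).isNat
    else none
  | _ + 2, _ => none

/-- Natural-numbers arithmetic as a structure: the base set consists of the natural numbers and
the logic elements, the operations are zero, successor and predecessor, and the sort of numbers is
represented by a unary relation. -/
noncomputable def ArithNames.arith (c : ArithNames S) : Struct S α where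
  voc := c.voc
  base := {e | ∀ a, e ≠ .atom a}
  fn := c.fn
  tt_mem := by simp
  ff_mem := by simp
  nil_mem := by simp
  dflt_mem := by
    intro f m _
    cases m.kind <;> simp [Kind.dflt]
  fn_mem := by
    intro f n xs y h
    have hd := c.distinct
    simp only [List.nodup_cons, List.mem_cons, List.not_mem_nil, not_or, or_false] at hd
    obtain ⟨⟨h1, h2, h3⟩, ⟨h4, h5⟩, h6, -⟩ := hd
    match n, xs, h with
    | 0, xs, h =>
      simp only [ArithNames.fn] at h
      split_ifs at h with hf
      obtain rfl := Option.some.inj h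
      exact ⟨⟨0, .intrinsic, .numerical⟩, by simp [ArithNames.voc, hf], rfl, ⟨0, rfl⟩,
        fun k => k.elim0, by simp⟩
    | 1, xs, h =>
      simp only [ArithNames.fn] at h
      split_ifs at h with ha hs hp hn
      · obtain rfl := Option.some.inj h
        have hx : ∀ k, xs k ∈ {e : Elem α | ∀ a, e ≠ .atom a} := by
          intro k a hk
          exact ha ⟨a, by rwa [Subsingleton.elim 0 k]⟩
        refine ⟨⟨1, .intrinsic, .numerical⟩, ?_, rfl, ?_, hx, ?_⟩
        · simp [ArithNames.voc, hs, Ne.symm h1]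
        · cases xs 0 <;> simp [Elem.succ, Kind.Allows]
        · cases xs 0 <;> simp [Elem.succ]
      · obtain rfl := Option.some.inj h
        have hx : ∀ k, xs k ∈ {e : Elem α | ∀ a, e ≠ .atom a} := by
          intro k a hk
          exact ha ⟨a, by rwa [Subsingleton.elim 0 k]⟩
        refine ⟨⟨1, .intrinsic, .numerical⟩, ?_, rfl, ?_, hx, ?_⟩
        · simp [ArithNames.voc, hp, Ne.symm h2]
        · cases xs 0 <;> simp [Elem.pred, Kind.Allows]
        · cases xs 0 <;> simp [Elem.pred]
      · obtain rfl := Option.some.inj h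
        have hx : ∀ k, xs k ∈ {e : Elem α | ∀ a, e ≠ .atom a} := by
          intro k a hk
          exact ha ⟨a, by rwa [Subsingleton.elim 0 k]⟩
        refine ⟨⟨1, .intrinsic, .relational⟩, ?_, rfl, ?_, hx, ?_⟩
        · simp [ArithNames.voc, hn, Ne.symm h3, Ne.symm h5, Ne.symm h6]
        · cases xs 0 <;> simp [Elem.isNat, Kind.Allows]
        · cases xs 0 <;> simp [Elem.isNat]
    | n + 2, xs, h => simp [ArithNames.fn] at h

/-! ## Terms -/

/-- Terms. The logic symbols are equality, `true`, `false`, `nil`, the Boolean connectives and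
if-then-else. -/
inductive Term (S : Type v)
  | app (f : S) (n : ℕ) (ts : Fin n → Term S)
  | tt
  | ff
  | nil
  | eq (s t : Term S)
  | not (t : Term S)
  | and (s t : Term S)
  | or (s t : Term S)
  | ite (c s t : Term S)

/-- `t` is a term of the vocabulary `V`. -/
def Term.WF (V : Vocabulary S) : Term S → Prop
  | .app f n ts => (∃ m, V.mark f = some m ∧ m.arity = n) ∧ ∀ k, (ts k).WF V
  | .tt | .ff | .nil => True
  | .not t => t.WF V
  | .eq s t | .and s t | .or s t => s.WF V ∧ t.WF V
  | .ite c s t => c.WF V ∧ s.WF V ∧ t.WF V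

/-- A term is Boolean if its head symbol is relational; the logic symbols other than `nil` and
if-then-else are relational. -/
def Term.IsBoolean (V : Vocabulary S) : Term S → Prop
  | .app f _ _ => ∃ m, V.mark f = some m ∧ m.kind = .relational
  | .nil | .ite _ _ _ => False
  | _ => True

/-- A tuple of possibly undefined values as a possibly undefined tuple of values. -/
def collect {n : ℕ} (v : Fin n → Option (Elem α)) : Option (Fin n → Elem α) :=
  if h : ∀ k, (v k).isSome then some fun k => (v k).get (h k) else none

/-- Negation; `false` at a non-Boolean argument. -/
def Elem.not : Elem α → Elem α
  | .ff => .tt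
  | _ => .ff

/-- Conjunction; `false` if an argument is not Boolean. -/
def Elem.and : Elem α → Elem α → Elem α
  | .tt, .tt => .tt
  | _, _ => .ff

/-- Disjunction; `false` if an argument is not Boolean. -/
def Elem.or : Elem α → Elem α → Elem α
  | .tt, .tt | .tt, .ff | .ff, .tt => .tt
  | _, _ => .ff

open Classical in
/-- The value of a term in a structure, `none` if it is undefined. Only the relevant branch of an
if-then-else is evaluated. -/
noncomputable def Term.eval (X : Struct S α) : Term S → Option (Elem α)
  | .app f n ts => (collect fun k => (ts k).eval X).bind (X.fn f n)
  | .tt => some .tt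
  | .ff => some .ff
  | .nil => some .nil
  | .eq s t => (s.eval X).bind fun a => (t.eval X).bind fun b =>
      some (if a = b then .tt else .ff)
  | .not t => (t.eval X).bind fun a => some a.not
  | .and s t => (s.eval X).bind fun a => (t.eval X).bind fun b => some (a.and b)
  | .or s t => (s.eval X).bind fun a => (t.eval X).bind fun b => some (a.or b)
  | .ite c s t => (c.eval X).bind fun a =>
      match a with
      | .tt => s.eval X
      | .ff => t.eval X
      | _ => some .nil

/-- A function symbol together with a tuple of arguments: a location if the symbol is dynamic, a
query if it is extrinsic. -/
@[ext] structure Loc (S : Type v) (α : Type u) where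
  sym : S
  arity : ℕ
  args : Fin arity → Elem α

/-- The content of a location. -/
def Struct.content (X : Struct S α) (l : Loc S α) : Option (Elem α) :=
  X.fn l.sym l.arity l.args

/-- The evaluation of the term in `X` involves evaluating the function `q.sym` at `q.args`. -/
def Term.Evaluates (X : Struct S α) : Term S → Loc S α → Prop
  | .app f n ts, q => (∃ k, (ts k).Evaluates X q) ∨
      ∃ xs, (collect fun k => (ts k).eval X) = some xs ∧ q = ⟨f, n, xs⟩
  | .tt, _ | .ff, _ | .nil, _ => False
  | .not t, q => t.Evaluates X q
  | .eq s t, q | .and s t, q | .or s t, q => s.Evaluates X q ∨ t.Evaluates X q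
  | .ite c s t, q => c.Evaluates X q ∨ (c.eval X = some .tt ∧ s.Evaluates X q) ∨
      (c.eval X = some .ff ∧ t.Evaluates X q)

/-! ## Rules -/

/-- Rules: assignments `f(ts) := t`, conditional rules and parallel rules. -/
inductive Rule (S : Type v)
  | assign (f : S) (n : ℕ) (ts : Fin n → Term S) (t : Term S)
  | cond (b : Term S) (P Q : Rule S)
  | par (P Q : Rule S)

/-- `R` is a rule of the vocabulary `V`. -/
def Rule.WF (V : Vocabulary S) : Rule S → Prop
  | .assign f n ts t => (∃ m, V.mark f = some m ∧ m.status = .dynamic ∧ m.arity = n) ∧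
      (∀ k, (ts k).WF V) ∧ t.WF V
  | .cond b P Q => b.WF V ∧ b.IsBoolean V ∧ P.WF V ∧ Q.WF V
  | .par P Q => P.WF V ∧ Q.WF V

/-- The update set that the rule produces in `X`, a set of pairs of a location and its new
content; `none` if the rule attempts to evaluate a function where it is undefined. -/
noncomputable def Rule.updates (X : Struct S α) : Rule S → Option (Set (Loc S α × Elem α))
  | .assign f n ts t => (collect fun k => (ts k).eval X).bind fun xs => (t.eval X).bind fun y =>
      some {(⟨f, n, xs⟩, y)}
  | .cond b P Q => (b.eval X).bind fun a =>
      match a with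
      | .tt => P.updates X
      | .ff => Q.updates X
      | _ => none
  | .par P Q => (P.updates X).bind fun D => (Q.updates X).bind fun E => some (D ∪ E)

/-- The execution of the rule in `X` involves evaluating the function `q.sym` at `q.args`. -/
def Rule.Evaluates (X : Struct S α) : Rule S → Loc S α → Prop
  | .assign _ _ ts t, q => (∃ k, (ts k).Evaluates X q) ∨ t.Evaluates X q
  | .cond b P Q, q => b.Evaluates X q ∨ (b.eval X = some .tt ∧ P.Evaluates X q) ∨
      (b.eval X = some .ff ∧ Q.Evaluates X q)
  | .par P Q, q => P.Evaluates X q ∨ Q.Evaluates X q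

/-- A successful execution of the rule at the structure `X` results in the structure `Y`. There is
no such `Y` if the execution fails: if a function is evaluated where it is undefined, if there are
contradictory updates, or if the result is not a structure because a relation (a numerical
function) is given a value which is not Boolean (not a number). -/
def Rule.Step (R : Rule S) (X Y : Struct S α) : Prop :=
  ∃ D, R.updates X = some D ∧
    (∀ p ∈ D, ∀ q ∈ D, p.1 = q.1 → p.2 = q.2) ∧
    Y.voc = X.voc ∧ Y.base = X.base ∧
    (∀ p ∈ D, Y.content p.1 = some p.2) ∧
    (∀ l, (∀ y, (l, y) ∉ D) → Y.content l = X.content l)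

/-! ## Algorithms -/

/-- A sequential abstract state machine set up to compute an `r`-ary function. Up to isomorphism,
its initial states differ only in the values of the input variables: the initial state for the
input `x` is obtained from `blank` by setting the input variables to `x`, where `x` is any
admissible input. All dynamic functions other than the input variables are initially
uninformative. -/
structure Algorithm (S : Type v) (α : Type u) (r : ℕ) where
  /-- the common part of the initial states, with the input variables at their defaults -/
  blank : Struct S α
  uninformative : ∀ f m, blank.voc.mark f = some m → m.status = .dynamic →
    ∀ xs : Fin m.arity → Elem α, (∀ k, xs k ∈ blank.base) →
      blank.fn f m.arity xs = some m.kind.dflt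
  program : Rule S
  program_wf : program.WF blank.voc
  /-- the input variables -/
  input : Fin r → S
  input_injective : Function.Injective input
  input_dynamic : ∀ k, ∃ m, blank.voc.mark (input k) = some m ∧ m.status = .dynamic ∧ m.arity = 0
  /-- the output variable -/
  output : S
  output_dynamic : ∃ m, blank.voc.mark output = some m ∧ m.status = .dynamic ∧ m.arity = 0
  output_ne_input : ∀ k, output ≠ input k
  /-- the admissible inputs -/
  dom : Set (Fin r → Elem α)
  dom_nonempty : dom.Nonempty
  dom_mem : ∀ x ∈ dom, ∀ k, x k ∈ blank.base ∧
    ∀ m, blank.voc.mark (input k) = some m → m.kind.Allows (x k)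

namespace Algorithm

variable {r : ℕ}

/-- `X` is the initial state for the input `x`. -/
structure IsInitial (A : Algorithm S α r) (x : Fin r → Elem α) (X : Struct S α) : Prop where
  voc : X.voc = A.blank.voc
  base : X.base = A.blank.base
  input : ∀ k, X.fn (A.input k) 0 ![] = some (x k)
  other : ∀ f, (∀ k, f ≠ A.input k) → X.fn f = A.blank.fn f

/-- The computation on input `x` passes through the state `X`. -/
def Reaches (A : Algorithm S α r) (x : Fin r → Elem α) (X : Struct S α) : Prop :=
  ∃ X₀, A.IsInitial x X₀ ∧ Relation.ReflTransGen A.program.Step X₀ X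

/-- The objective function of `A` as a relation: on the admissible input `x`, the computation
reaches a state which is left unchanged by the program (the computation has terminated), and the
value of the output variable is `y` there. In particular, the objective function is undefined at
`x` if the computation fails or goes on changing the state forever. -/
def Computes (A : Algorithm S α r) (x : Fin r → Elem α) (y : Elem α) : Prop :=
  x ∈ A.dom ∧ ∃ X, A.Reaches x X ∧ A.program.Step X X ∧ X.fn A.output 0 ![] = some y

/-- `f` is an intrinsic function symbol of `A`. -/
def IsIntrinsic (A : Algorithm S α r) (f : S) : Prop :=
  ∃ m, A.blank.voc.mark f = some m ∧ m.status = .intrinsic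

/-- `e` is an extrinsic function symbol of `A`. -/
def IsExtrinsic (A : Algorithm S α r) (e : S) : Prop :=
  ∃ m, A.blank.voc.mark e = some m ∧ m.status = .extrinsic

/-- In the course of its computation on input `x`, the algorithm poses the extrinsic query
`q.sym` at `q.args`. -/
def Poses (A : Algorithm S α r) (x : Fin r → Elem α) (q : Loc S α) : Prop :=
  A.IsExtrinsic q.sym ∧ ∃ X, A.Reaches x X ∧ A.program.Evaluates X q

open Classical in
/-- The vocabulary of the datastructure: the intrinsic symbols. -/
noncomputable def intrinsicVoc (A : Algorithm S α r) : Vocabulary S where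
  mark f := if A.IsIntrinsic f then A.blank.voc.mark f else none
  finite := by
    refine Set.Finite.subset A.blank.voc.finite ?_
    intro f hf h
    exact hf (by rw [h, ite_self])

theorem mark_of_intrinsicVoc {A : Algorithm S α r} {f : S} {m : Mark}
    (h : A.intrinsicVoc.mark f = some m) : A.IsIntrinsic f ∧ A.blank.voc.mark f = some m := by
  unfold intrinsicVoc at h
  by_cases hi : A.IsIntrinsic f <;> simp_all

open Classical in
/-- The datastructure of `A`: the base set with the intrinsic functions. -/
noncomputable def datastructure (A : Algorithm S α r) : Struct S α where
  voc := A.intrinsicVoc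
  base := A.blank.base
  fn := fun f n xs => if A.IsIntrinsic f then A.blank.fn f n xs else none
  tt_mem := A.blank.tt_mem
  ff_mem := A.blank.ff_mem
  nil_mem := A.blank.nil_mem
  dflt_mem := fun f m h => A.blank.dflt_mem f m (mark_of_intrinsicVoc h).2
  fn_mem := by
    intro f n xs y h
    by_cases hi : A.IsIntrinsic f
    · rw [if_pos hi] at h
      obtain ⟨m, hm, h'⟩ := A.blank.fn_mem f n xs y h
      exact ⟨m, by simp [intrinsicVoc, hi, hm], h'⟩
    · rw [if_neg hi] at h
      cases h

/-- A numerical algorithm: every state incorporates natural-numbers arithmetic. -/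
def IsNumerical (A : Algorithm S α r) : Prop :=
  ∃ c : ArithNames S, ∀ x ∈ A.dom, ∀ X, A.Reaches x X → X.Incorporates c.arith

end Algorithm

/-! ## Mutually recursive systems of algorithms -/

variable {N : ℕ} {r : Fin N → ℕ}

/-- The extrinsic function `e` of `A` is the objective function of `B`: it has the arity of the
objective function, agrees with it at the admissible inputs of `B` (both values are defined and
equal, or both are undefined), and `A` queries `e` only at admissible inputs of `B`. -/
structure IsObjective {k l : ℕ} (A : Algorithm S α k) (e : S) (B : Algorithm S α l) : Prop where
  arity : ∀ m, A.blank.voc.mark e = some m → m.arity = l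
  agree : ∀ x ∈ B.dom, (∀ i, x i ∈ A.blank.base) →
    ∀ y, A.blank.fn e l x = some y ↔ B.Computes x y
  query : ∀ z ∈ A.dom, ∀ x : Fin l → Elem α, A.Poses z ⟨e, l, x⟩ → x ∈ B.dom

/-- `Calls A callee p q`: in the course of its computation on the input `p.2`, the algorithm with
the index `p.1` poses a query to be answered by the algorithm with the index `q.1` on the input
`q.2`; here `callee i e` is the index of the algorithm behind the extrinsic function `e` of the
algorithm with the index `i`. -/
def Calls (A : ∀ i, Algorithm S α (r i)) (callee : Fin N → S → Fin N)
    (p q : Σ i, Fin (r i) → Elem α) : Prop :=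
  ∃ e, callee p.1 e = q.1 ∧ (A p.1).Poses p.2 ⟨e, r q.1, q.2⟩

end SeqASM

namespace SeqASM

universe u v
variable {S : Type v} {α : Type u}

/-! ## Evaluation -/

/-! `B` evaluates the mutual recursion by memoization, without a call stack. It keeps a table
(`known`, `val`) of the values of the objective functions found so far. A run simulates one
algorithm on one input. Before each simulated step, `B` searches for a query which the step poses
and the table does not answer, looking at arguments before the query itself. If there is one, the
current run is abandoned for good and a new run is started for that query. If there is none, the
answers are read from the table and the step is carried out. When the simulated algorithm reaches a
fixed state, its result enters the table and `B` starts over from the main input, until the table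
contains the value of the objective function of `A 0` there.

A single step changes only boundedly many locations, so the dynamic functions of an abandoned run
cannot simply be reset. Instead, each run works on its own copy, addressed by the run number as an
additional first argument; copies with unused numbers still have their default values, as an initial
state requires. The arguments of a run are also stored apart from the simulated input variables,
since the simulated program may overwrite those.

Soundness (`computes_of_sim`): the table holds only correct values (`Inv.memo`), hence translated
terms have the right values (`tr_eval`) and every simulated state is a genuine one. All steps except
writing out a recorded result change the state, so `B` can only stop with a correct output. This
direction needs no assumption on the recursion.

Completeness (`sim_computes`): a terminating computation poses finitely many queries, all with
defined answers, so by well-foundedness the call tree is finite (`finite_callTree`). Between two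
idle states, the successive runs descend in the call tree; some run must therefore finish, which
adds a new entry to the table (`Inv.run_completes`). After finitely many rounds the main value is
known (`Inv.reaches_known`). -/

theorem collect_eq_some {n : ℕ} {v : Fin n → Option (Elem α)} {xs : Fin n → Elem α} :
    collect v = some xs ↔ ∀ k, v k = some (xs k) := by
  unfold collect
  constructor
  · intro h k
    split_ifs at h with hv
    obtain rfl := Option.some.inj h
    simp
  · intro h
    have hv : ∀ k, (v k).isSome := fun k => by simp [h k]
    rw [dif_pos hv]
    congr 1
    funext k
    simp [h k]

theorem collect_eq_none {n : ℕ} {v : Fin n → Option (Elem α)} :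
    collect v = none ↔ ∃ k, v k = none := by
  unfold collect
  split_ifs with hv
  · simp only [false_iff, not_exists]
    intro k hk
    simpa [hk] using hv k
  · simp only [true_iff]
    push Not at hv
    simpa using hv

theorem Term.eval_app_of {X : Struct S α} {f : S} {n : ℕ} {ts : Fin n → Term S}
    {xs : Fin n → Elem α} (h : ∀ k, (ts k).eval X = some (xs k)) :
    (Term.app f n ts).eval X = X.fn f n xs := by
  rw [Term.eval, collect_eq_some.2 h]
  rfl

theorem Term.eval_mem {X : Struct S α} : ∀ (t : Term S) {y : Elem α}, t.eval X = some y →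
    y ∈ X.base := by
  have hb : ∀ y : Elem α, y = .tt ∨ y = .ff → y ∈ X.base := by
    rintro y (rfl | rfl)
    · exact X.tt_mem
    · exact X.ff_mem
  intro t
  induction t with
  | app f n ts _ =>
    intro y h
    obtain ⟨xs, -, h⟩ := Option.bind_eq_some_iff.1 h
    obtain ⟨m, hm⟩ := X.fn_mem f n xs y h
    exact hm.2.2.2.2
  | tt => intro y h; obtain rfl := Option.some.inj h; exact X.tt_mem
  | ff => intro y h; obtain rfl := Option.some.inj h; exact X.ff_mem
  | nil => intro y h; obtain rfl := Option.some.inj h; exact X.nil_mem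
  | eq s t _ _ =>
    intro y h
    obtain ⟨a, -, h⟩ := Option.bind_eq_some_iff.1 h
    obtain ⟨b, -, h⟩ := Option.bind_eq_some_iff.1 h
    obtain rfl := Option.some.inj h
    apply hb
    split_ifs <;> simp
  | not t _ =>
    intro y h
    obtain ⟨a, -, h⟩ := Option.bind_eq_some_iff.1 h
    obtain rfl := Option.some.inj h
    apply hb
    cases a <;> simp [Elem.not]
  | and s t _ _ =>
    intro y h
    obtain ⟨a, -, h⟩ := Option.bind_eq_some_iff.1 h
    obtain ⟨b, -, h⟩ := Option.bind_eq_some_iff.1 h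
    obtain rfl := Option.some.inj h
    apply hb
    cases a <;> cases b <;> simp [Elem.and]
  | or s t _ _ =>
    intro y h
    obtain ⟨a, -, h⟩ := Option.bind_eq_some_iff.1 h
    obtain ⟨b, -, h⟩ := Option.bind_eq_some_iff.1 h
    obtain rfl := Option.some.inj h
    apply hb
    cases a <;> cases b <;> simp [Elem.or]
  | ite c s t _ ihs iht =>
    intro y h
    obtain ⟨a, -, h⟩ := Option.bind_eq_some_iff.1 h
    split at h
    · exact ihs h
    · exact iht h
    · obtain rfl := Option.some.inj h
      exact X.nil_mem

theorem Term.collect_mem {X : Struct S α} {n : ℕ} {ts : Fin n → Term S} {xs : Fin n → Elem α}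
    (h : (collect fun k => (ts k).eval X) = some xs) (k : Fin n) : xs k ∈ X.base :=
  (ts k).eval_mem (collect_eq_some.1 h k)

theorem Term.IsBoolean.eval {X : Struct S α} : ∀ {t : Term S}, t.IsBoolean X.voc →
    ∀ {y : Elem α}, t.eval X = some y → y = .tt ∨ y = .ff := by
  intro t ht y h
  cases t with
  | app f n ts =>
    obtain ⟨xs, -, h⟩ := Option.bind_eq_some_iff.1 h
    obtain ⟨m, hm, hk⟩ := ht
    obtain ⟨m', hm', -, ha, -⟩ := X.fn_mem f n xs y h
    obtain rfl := Option.some.inj (hm.symm.trans hm')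
    simpa [hk, Kind.Allows] using ha
  | tt => obtain rfl := Option.some.inj h; simp
  | ff => obtain rfl := Option.some.inj h; simp
  | nil => exact ht.elim
  | eq s t =>
    obtain ⟨a, -, h⟩ := Option.bind_eq_some_iff.1 h
    obtain ⟨b, -, h⟩ := Option.bind_eq_some_iff.1 h
    obtain rfl := Option.some.inj h
    split_ifs <;> simp
  | not t =>
    obtain ⟨a, -, h⟩ := Option.bind_eq_some_iff.1 h
    obtain rfl := Option.some.inj h
    cases a <;> simp [Elem.not]
  | and s t =>
    obtain ⟨a, -, h⟩ := Option.bind_eq_some_iff.1 h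
    obtain ⟨b, -, h⟩ := Option.bind_eq_some_iff.1 h
    obtain rfl := Option.some.inj h
    cases a <;> cases b <;> simp [Elem.and]
  | or s t =>
    obtain ⟨a, -, h⟩ := Option.bind_eq_some_iff.1 h
    obtain ⟨b, -, h⟩ := Option.bind_eq_some_iff.1 h
    obtain rfl := Option.some.inj h
    cases a <;> cases b <;> simp [Elem.or]
  | ite c s t => exact ht.elim

theorem Term.Evaluates.args_mem {X : Struct S α} : ∀ {t : Term S} {q : Loc S α},
    t.Evaluates X q → ∀ k, q.args k ∈ X.base := by
  intro t
  induction t with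
  | app f n ts ih =>
    rintro q (⟨k, h⟩ | ⟨xs, hxs, rfl⟩)
    · exact ih k h
    · exact Term.collect_mem hxs
  | tt => exact fun h => h.elim
  | ff => exact fun h => h.elim
  | nil => exact fun h => h.elim
  | not t ih => exact fun h => ih h
  | eq s t ihs iht => exact fun h => h.elim ihs iht
  | and s t ihs iht => exact fun h => h.elim ihs iht
  | or s t ihs iht => exact fun h => h.elim ihs iht
  | ite c s t ihc ihs iht =>
    rintro q (h | ⟨-, h⟩ | ⟨-, h⟩)
    exacts [ihc h, ihs h, iht h]

theorem Rule.Evaluates.args_mem {X : Struct S α} : ∀ {R : Rule S} {q : Loc S α},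
    R.Evaluates X q → ∀ k, q.args k ∈ X.base := by
  intro R
  induction R with
  | assign f n ts t =>
    rintro q (⟨k, h⟩ | h)
    exacts [h.args_mem, h.args_mem]
  | cond b P Q ihP ihQ =>
    rintro q (h | ⟨-, h⟩ | ⟨-, h⟩)
    exacts [h.args_mem, ihP h, ihQ h]
  | par P Q ihP ihQ =>
    rintro q (h | h)
    exacts [ihP h, ihQ h]

/-- Evaluation is strict in everything it visits, and `Evaluates` follows only the chosen branch of
an if-then-else. This is what makes the queries of a terminating computation have answers. -/
theorem Term.Evaluates.isSome {X : Struct S α} : ∀ {t : Term S} {q : Loc S α},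
    t.Evaluates X q → t.eval X ≠ none → X.content q ≠ none := by
  intro t
  induction t with
  | app f n ts ih =>
    rintro q (⟨k, h⟩ | ⟨xs, hxs, rfl⟩) h'
    · refine ih k h fun h0 => h' ?_
      rw [Term.eval, collect_eq_none.2 ⟨k, h0⟩]
      rfl
    · rwa [Term.eval, hxs] at h'
  | tt => exact fun h => h.elim
  | ff => exact fun h => h.elim
  | nil => exact fun h => h.elim
  | not t ih => exact fun h h' => ih h fun h0 => h' (by simp [Term.eval, h0])
  | eq s t ihs iht =>
    rintro q (h | h) h'
    · exact ihs h fun h0 => h' (by simp [Term.eval, h0])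
    · exact iht h fun h0 => h' (by simp [Term.eval, h0])
  | and s t ihs iht =>
    rintro q (h | h) h'
    · exact ihs h fun h0 => h' (by simp [Term.eval, h0])
    · exact iht h fun h0 => h' (by simp [Term.eval, h0])
  | or s t ihs iht =>
    rintro q (h | h) h'
    · exact ihs h fun h0 => h' (by simp [Term.eval, h0])
    · exact iht h fun h0 => h' (by simp [Term.eval, h0])
  | ite c s t ihc ihs iht =>
    rintro q (h | ⟨hc, h⟩ | ⟨hc, h⟩) h'
    · exact ihc h fun h0 => h' (by simp [Term.eval, h0])
    · exact ihs h fun h0 => h' (by simp [Term.eval, hc, h0])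
    · exact iht h fun h0 => h' (by simp [Term.eval, hc, h0])

theorem Rule.Evaluates.isSome {X : Struct S α} : ∀ {R : Rule S} {q : Loc S α},
    R.Evaluates X q → R.updates X ≠ none → X.content q ≠ none := by
  intro R
  induction R with
  | assign f n ts t =>
    rintro q (⟨k, h⟩ | h) h'
    · refine h.isSome fun h0 => h' ?_
      rw [Rule.updates, collect_eq_none.2 ⟨k, h0⟩]
      rfl
    · exact h.isSome fun h0 => h' (by simp [Rule.updates, h0])
  | cond b P Q ihP ihQ =>
    rintro q (h | ⟨hb, h⟩ | ⟨hb, h⟩) h'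
    · exact h.isSome fun h0 => h' (by simp [Rule.updates, h0])
    · exact ihP h fun h0 => h' (by simp [Rule.updates, hb, h0])
    · exact ihQ h fun h0 => h' (by simp [Rule.updates, hb, h0])
  | par P Q ihP ihQ =>
    rintro q (h | h) h'
    · exact ihP h fun h0 => h' (by simp [Rule.updates, h0])
    · exact ihQ h fun h0 => h' (by simp [Rule.updates, h0])

/-- Each application inside the term contributes at most one location, because the values of its
arguments are unique. -/
theorem Term.finite_evaluates (X : Struct S α) (t : Term S) : {q | t.Evaluates X q}.Finite := by
  induction t with
  | app f n ts ih =>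
    have h : {q : Loc S α | ∃ xs, (collect fun k => (ts k).eval X) = some xs ∧
        q = ⟨f, n, xs⟩}.Finite := by
      refine Set.Subsingleton.finite ?_
      rintro _ ⟨xs, h, rfl⟩ _ ⟨ys, h', rfl⟩
      obtain rfl := Option.some.inj (h.symm.trans h')
      rfl
    refine ((Set.finite_iUnion ih).union h).subset ?_
    rintro q (⟨k, hk⟩ | hq)
    · exact Or.inl (Set.mem_iUnion.2 ⟨k, hk⟩)
    · exact Or.inr hq
  | tt => exact Set.finite_empty
  | ff => exact Set.finite_empty
  | nil => exact Set.finite_empty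
  | not t ih => exact ih
  | eq s t ihs iht => exact ihs.union iht
  | and s t ihs iht => exact ihs.union iht
  | or s t ihs iht => exact ihs.union iht
  | ite c s t ihc ihs iht =>
    refine ((ihc.union ihs).union iht).subset ?_
    rintro q (h | ⟨-, h⟩ | ⟨-, h⟩)
    exacts [Or.inl (Or.inl h), Or.inl (Or.inr h), Or.inr h]

theorem Rule.finite_evaluates (X : Struct S α) (R : Rule S) : {q | R.Evaluates X q}.Finite := by
  induction R with
  | assign f n ts t =>
    refine ((Set.finite_iUnion fun k => (ts k).finite_evaluates X).union
      (t.finite_evaluates X)).subset ?_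
    rintro q (⟨k, hk⟩ | hq)
    · exact Or.inl (Set.mem_iUnion.2 ⟨k, hk⟩)
    · exact Or.inr hq
  | cond b P Q ihP ihQ =>
    refine (((b.finite_evaluates X).union ihP).union ihQ).subset ?_
    rintro q (h | ⟨-, h⟩ | ⟨-, h⟩)
    exacts [Or.inl (Or.inl h), Or.inl (Or.inr h), Or.inr h]
  | par P Q ihP ihQ => exact ihP.union ihQ

/-! ## Updates and steps -/

theorem Rule.WF.updates_mem {X : Struct S α} : ∀ {R : Rule S}, R.WF X.voc →
    ∀ {D : Set (Loc S α × Elem α)}, R.updates X = some D → ∀ p ∈ D,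
      (∃ m, X.voc.mark p.1.sym = some m ∧ m.status = .dynamic ∧ m.arity = p.1.arity) ∧
        (∀ k, p.1.args k ∈ X.base) ∧ p.2 ∈ X.base := by
  intro R
  induction R with
  | assign f n ts t =>
    intro hR D h p hp
    obtain ⟨xs, hxs, h⟩ := Option.bind_eq_some_iff.1 h
    obtain ⟨y, hy, h⟩ := Option.bind_eq_some_iff.1 h
    obtain rfl := Option.some.inj h
    obtain rfl := Set.mem_singleton_iff.1 hp
    exact ⟨hR.1, Term.collect_mem hxs, t.eval_mem hy⟩
  | cond b P Q ihP ihQ =>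
    intro hR D h
    obtain ⟨a, -, h⟩ := Option.bind_eq_some_iff.1 h
    split at h
    · exact ihP hR.2.2.1 h
    · exact ihQ hR.2.2.2 h
    · cases h
  | par P Q ihP ihQ =>
    intro hR D h p hp
    obtain ⟨D₁, h₁, h⟩ := Option.bind_eq_some_iff.1 h
    obtain ⟨D₂, h₂, h⟩ := Option.bind_eq_some_iff.1 h
    obtain rfl := Option.some.inj h
    rcases hp with hp | hp
    exacts [ihP hR.1 h₁ p hp, ihQ hR.2 h₂ p hp]

/-- `Y` results from `X` by the updates in `D`. -/
structure Struct.IsUpdate (X : Struct S α) (D : Set (Loc S α × Elem α)) (Y : Struct S α) :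
    Prop where
  voc : Y.voc = X.voc
  base : Y.base = X.base
  content : ∀ p ∈ D, Y.content p.1 = some p.2
  other : ∀ l, (∀ y, (l, y) ∉ D) → Y.content l = X.content l

/-- A location has only one content in the result, so the consistency clause in `Rule.Step` is
automatic once a result exists. -/
theorem Struct.IsUpdate.consistent {X Y : Struct S α} {D : Set (Loc S α × Elem α)}
    (h : X.IsUpdate D Y) : ∀ p ∈ D, ∀ q ∈ D, p.1 = q.1 → p.2 = q.2 := by
  intro p hp q hq hpq
  have := h.content p hp
  rw [hpq, h.content q hq] at this
  exact (Option.some.inj this).symm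

theorem Rule.step_iff {R : Rule S} {X Y : Struct S α} :
    R.Step X Y ↔ ∃ D, R.updates X = some D ∧ X.IsUpdate D Y := by
  constructor
  · rintro ⟨D, h, -, h1, h2, h3, h4⟩
    exact ⟨D, h, h1, h2, h3, h4⟩
  · rintro ⟨D, h, hu⟩
    exact ⟨D, h, hu.consistent, hu.voc, hu.base, hu.content, hu.other⟩

/-- Termination amounts to triviality of all updates; this is the condition that the term `stable`
tests. -/
theorem Rule.step_self_iff {R : Rule S} {X : Struct S α} :
    R.Step X X ↔ ∃ D, R.updates X = some D ∧ ∀ p ∈ D, X.content p.1 = some p.2 := by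
  rw [Rule.step_iff]
  exact ⟨fun ⟨D, h, hu⟩ => ⟨D, h, hu.content⟩,
    fun ⟨D, h, hu⟩ => ⟨D, h, rfl, rfl, hu, fun _ _ => rfl⟩⟩

theorem Struct.ext_content {X Y : Struct S α} (hv : X.voc = Y.voc) (hb : X.base = Y.base)
    (h : ∀ l, X.content l = Y.content l) : X = Y :=
  Struct.ext hv hb (by funext f n xs; exact h ⟨f, n, xs⟩)

theorem Struct.IsUpdate.unique {X Y Z : Struct S α} {D : Set (Loc S α × Elem α)}
    (hY : X.IsUpdate D Y) (hZ : X.IsUpdate D Z) : Y = Z := by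
  refine Struct.ext_content (hY.voc.trans hZ.voc.symm) (hY.base.trans hZ.base.symm) fun l => ?_
  by_cases h : ∃ y, (l, y) ∈ D
  · obtain ⟨y, hy⟩ := h
    exact (hY.content _ hy).trans (hZ.content _ hy).symm
  · push Not at h
    exact (hY.other l h).trans (hZ.other l h).symm

theorem Rule.Step.unique {R : Rule S} {X Y Z : Struct S α} (hY : R.Step X Y) (hZ : R.Step X Z) :
    Y = Z := by
  obtain ⟨D, hD, hY⟩ := Rule.step_iff.1 hY
  obtain ⟨E, hE, hZ⟩ := Rule.step_iff.1 hZ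
  obtain rfl := Option.some.inj (hD.symm.trans hE)
  exact hY.unique hZ

theorem Rule.Step.eq_of_reflTransGen {R : Rule S} {X Y : Struct S α} (hX : R.Step X X)
    (h : Relation.ReflTransGen R.Step X Y) : X = Y := by
  induction h with
  | refl => rfl
  | tail _ h ih => subst ih; exact hX.unique h

open Classical in
theorem Struct.exists_isUpdate (X : Struct S α) (D : Set (Loc S α × Elem α))
    (hc : ∀ p ∈ D, ∀ q ∈ D, p.1 = q.1 → p.2 = q.2)
    (hD : ∀ p ∈ D, (∃ m, X.voc.mark p.1.sym = some m ∧ m.arity = p.1.arity ∧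
      m.kind.Allows p.2) ∧ (∀ k, p.1.args k ∈ X.base) ∧ p.2 ∈ X.base) :
    ∃ Y, X.IsUpdate D Y := by
  refine ⟨{ X with
    fn := fun f n xs => if h : ∃ y, ((⟨f, n, xs⟩ : Loc S α), y) ∈ D then some h.choose
      else X.fn f n xs
    fn_mem := ?_ }, rfl, rfl, ?_, ?_⟩
  · intro f n xs y h
    split_ifs at h with hy
    · obtain rfl := Option.some.inj h
      obtain ⟨⟨m, h1, h2, h3⟩, h4, h5⟩ := hD _ hy.choose_spec
      exact ⟨m, h1, h2, h3, h4, h5⟩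
    · exact X.fn_mem f n xs y h
  · rintro ⟨l, y⟩ hp
    have hy : ∃ y, ((⟨l.sym, l.arity, l.args⟩ : Loc S α), y) ∈ D := ⟨y, hp⟩
    simp only [Struct.content]
    rw [dif_pos hy]
    exact congrArg some (hc _ hy.choose_spec _ hp rfl)
  · intro l hl
    simp only [Struct.content]
    rw [dif_neg]
    rintro ⟨y, hy⟩
    exact hl y hy

theorem Rule.WF.exists_step {X : Struct S α} {R : Rule S} (hR : R.WF X.voc)
    {D : Set (Loc S α × Elem α)} (h : R.updates X = some D)
    (hc : ∀ p ∈ D, ∀ q ∈ D, p.1 = q.1 → p.2 = q.2)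
    (hD : ∀ p ∈ D, ∀ m, X.voc.mark p.1.sym = some m → m.kind.Allows p.2) :
    ∃ Y, R.Step X Y := by
  obtain ⟨Y, hY⟩ := X.exists_isUpdate D hc fun p hp => by
    obtain ⟨⟨m, h1, -, h2⟩, h3⟩ := hR.updates_mem h p hp
    exact ⟨⟨m, h1, h2, hD p hp m h1⟩, h3⟩
  exact ⟨Y, Rule.step_iff.2 ⟨D, h, hY⟩⟩

/-! ## States of an algorithm -/

namespace Algorithm

variable {r : ℕ} {A : Algorithm S α r}

/-- What the states of an algorithm have in common: the static part is that of the blank state,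
and the dynamic functions are total. -/
structure IsState (A : Algorithm S α r) (X : Struct S α) : Prop where
  voc : X.voc = A.blank.voc
  base : X.base = A.blank.base
  static : ∀ f m, A.blank.voc.mark f = some m → m.status ≠ .dynamic → X.fn f = A.blank.fn f
  total : ∀ f m, A.blank.voc.mark f = some m → m.status = .dynamic →
    ∀ xs : Fin m.arity → Elem α, (∀ k, xs k ∈ A.blank.base) → X.fn f m.arity xs ≠ none

theorem IsInitial.isState {x : Fin r → Elem α} {X : Struct S α} (h : A.IsInitial x X) :
    A.IsState X where
  voc := h.voc
  base := h.base
  static f m hm hs := by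
    refine h.other f ?_
    rintro k rfl
    obtain ⟨m', hm', hs', -⟩ := A.input_dynamic k
    obtain rfl := Option.some.inj (hm.symm.trans hm')
    exact hs hs'
  total f m hm hs xs hxs := by
    by_cases hf : ∃ k, f = A.input k
    · obtain ⟨k, rfl⟩ := hf
      obtain ⟨m', hm', -, ha⟩ := A.input_dynamic k
      obtain rfl := Option.some.inj (hm.symm.trans hm')
      obtain ⟨a, s, κ⟩ := m
      obtain rfl : a = 0 := ha
      rw [Subsingleton.elim xs ![], h.input k]
      simp
    · push Not at hf
      rw [h.other f hf, A.uninformative f m hm hs xs hxs]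
      simp

theorem IsState.step {X Y : Struct S α} (hX : A.IsState X) (h : A.program.Step X Y) :
    A.IsState Y := by
  obtain ⟨D, hD, hu⟩ := Rule.step_iff.1 h
  have hmem := Rule.WF.updates_mem (X := X) (by rw [hX.voc]; exact A.program_wf) hD
  refine ⟨hu.voc.trans hX.voc, hu.base.trans hX.base, fun f m hm hs => ?_,
    fun f m hm hs xs hxs => ?_⟩
  · rw [← hX.static f m hm hs]
    funext n xs
    refine hu.other ⟨f, n, xs⟩ fun y hy => ?_
    obtain ⟨⟨m', hm', hs', -⟩, -⟩ := hmem _ hy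
    rw [hX.voc] at hm'
    obtain rfl := Option.some.inj (hm.symm.trans hm')
    exact hs hs'
  · by_cases hl : ∃ y, ((⟨f, m.arity, xs⟩ : Loc S α), y) ∈ D
    · obtain ⟨y, hy⟩ := hl
      have := hu.content _ hy
      simp only [Struct.content] at this
      simp [this]
    · push Not at hl
      have := hu.other _ hl
      simp only [Struct.content] at this
      rw [this]
      exact hX.total f m hm hs xs hxs

theorem Reaches.isState {x : Fin r → Elem α} {X : Struct S α} (h : A.Reaches x X) :
    A.IsState X := by
  obtain ⟨X₀, h₀, h⟩ := h
  induction h with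
  | refl => exact h₀.isState
  | tail _ hs ih => exact ih.step hs

theorem Reaches.step {x : Fin r → Elem α} {X Y : Struct S α} (h : A.Reaches x X)
    (hs : A.program.Step X Y) : A.Reaches x Y := by
  obtain ⟨X₀, h₀, h⟩ := h
  exact ⟨X₀, h₀, h.tail hs⟩

theorem IsInitial.unique {x : Fin r → Elem α} {X Y : Struct S α} (hX : A.IsInitial x X)
    (hY : A.IsInitial x Y) : X = Y := by
  refine Struct.ext (hX.voc.trans hY.voc.symm) (hX.base.trans hY.base.symm) ?_
  funext f
  by_cases hf : ∃ k, f = A.input k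
  · obtain ⟨k, rfl⟩ := hf
    obtain ⟨m, hm, -, ha⟩ := A.input_dynamic k
    -- `IsInitial` fixes an input variable at the empty tuple only; at other lengths `fn_mem` leaves
    -- no value.
    have key : ∀ Z : Struct S α, A.IsInitial x Z → ∀ n (xs : Fin n → Elem α), n ≠ 0 →
        Z.fn (A.input k) n xs = none := by
      intro Z hZ n xs hn
      by_contra h
      obtain ⟨y, hy⟩ := Option.ne_none_iff_exists'.1 h
      obtain ⟨m', hm', ha', -⟩ := Z.fn_mem _ _ _ _ hy
      rw [hZ.voc] at hm'
      obtain rfl := Option.some.inj (hm.symm.trans hm')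
      exact hn (ha'.symm.trans ha)
    funext n xs
    by_cases hn : n = 0
    · subst hn
      rw [Subsingleton.elim xs ![], hX.input, hY.input]
    · rw [key X hX n xs hn, key Y hY n xs hn]
  · push Not at hf
    rw [hX.other f hf, hY.other f hf]

theorem exists_isInitial {x : Fin r → Elem α} (hx : x ∈ A.dom) : ∃ X, A.IsInitial x X := by
  obtain ⟨X, hX⟩ := A.blank.exists_isUpdate
    {p | ∃ k, p = ((⟨A.input k, 0, ![]⟩ : Loc S α), x k)} (by
      rintro _ ⟨k, rfl⟩ _ ⟨l, rfl⟩ h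
      rw [A.input_injective (congrArg Loc.sym h)]) (by
      rintro _ ⟨k, rfl⟩
      obtain ⟨m, hm, -, ha⟩ := A.input_dynamic k
      exact ⟨⟨m, hm, ha, (A.dom_mem x hx k).2 m hm⟩, fun k => k.elim0, (A.dom_mem x hx k).1⟩)
  refine ⟨X, hX.voc, hX.base, fun k => hX.content _ ⟨k, rfl⟩, fun f hf => ?_⟩
  funext n xs
  refine hX.other ⟨f, n, xs⟩ ?_
  rintro y ⟨k, hk⟩
  exact hf k (congrArg (fun p => p.1.sym) hk)

/-- Steps are deterministic, so the states reached on one input are linearly ordered, and a fixed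
state can only come last. -/
theorem Reaches.reflTransGen {x : Fin r → Elem α} {X Y : Struct S α} (hX : A.Reaches x X)
    (hY : A.Reaches x Y) (hs : A.program.Step Y Y) :
    Relation.ReflTransGen A.program.Step X Y := by
  obtain ⟨X₀, h₀, hX⟩ := hX
  obtain ⟨Y₀, h₀', hY⟩ := hY
  obtain rfl := h₀.unique h₀'
  rcases Relation.ReflTransGen.total_of_right_unique (fun _ _ _ h h' => h.unique h') hX hY
    with h | h
  · exact h
  · rw [hs.eq_of_reflTransGen h]

/-- The objective function is single-valued. -/
theorem Computes.unique {x : Fin r → Elem α} {y z : Elem α} (hy : A.Computes x y)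
    (hz : A.Computes x z) : y = z := by
  obtain ⟨-, X, hX, hXX, hy⟩ := hy
  obtain ⟨-, Y, hY, hYY, hz⟩ := hz
  obtain rfl : X = Y := hXX.eq_of_reflTransGen (hX.reflTransGen hY hYY)
  exact Option.some.inj (hy.symm.trans hz)

theorem Computes.exists_step {x : Fin r → Elem α} {y : Elem α} (h : A.Computes x y)
    {X : Struct S α} (hX : A.Reaches x X) : ∃ Y, A.program.Step X Y := by
  obtain ⟨-, Y, hY, hs, -⟩ := h
  rcases (hX.reflTransGen hY hs).cases_head with rfl | ⟨Z, hZ, -⟩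
  exacts [⟨_, hs⟩, ⟨Z, hZ⟩]

theorem Computes.finite_reaches {x : Fin r → Elem α} {y : Elem α} (h : A.Computes x y) :
    {X | A.Reaches x X}.Finite := by
  obtain ⟨-, Y, ⟨X₀, h₀, hY⟩, hs, -⟩ := h
  suffices {X | Relation.ReflTransGen A.program.Step X₀ X}.Finite by
    refine this.subset ?_
    rintro X ⟨X₁, h₁, hX⟩
    obtain rfl := h₀.unique h₁
    exact hX
  clear h₀
  induction hY using Relation.ReflTransGen.head_induction_on with
  | refl =>
    exact (Set.finite_singleton Y).subset fun X hX => (hs.eq_of_reflTransGen hX).symm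
  | @head a b hab _ ih =>
    refine (ih.insert a).subset fun X hX => ?_
    rcases Relation.ReflTransGen.cases_head hX with rfl | ⟨b', hb', hX⟩
    · exact Or.inl rfl
    · obtain rfl := hab.unique hb'
      exact Or.inr hX

theorem Computes.finite_poses {x : Fin r → Elem α} {y : Elem α} (h : A.Computes x y) :
    {q | A.Poses x q}.Finite := by
  refine (h.finite_reaches.biUnion fun X _ => A.program.finite_evaluates X).subset ?_
  rintro q ⟨-, X, hX, hq⟩
  exact Set.mem_biUnion hX hq

/-- No step fails in a computation that terminates, so whatever is evaluated is defined; extrinsic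
functions are the same in all states as in `blank`. -/
theorem Computes.isSome_of_poses {x : Fin r → Elem α} {y : Elem α} (h : A.Computes x y)
    {q : Loc S α} (hq : A.Poses x q) :
    (∀ k, q.args k ∈ A.blank.base) ∧ A.blank.content q ≠ none := by
  obtain ⟨⟨m, hm, hms⟩, X, hX, hq⟩ := hq
  obtain ⟨Y, hY⟩ := h.exists_step hX
  obtain ⟨D, hD, -⟩ := hY
  have hst := hX.isState
  refine ⟨fun k => hst.base ▸ hq.args_mem k, ?_⟩
  have := hq.isSome (by rw [hD]; simp)
  rwa [Struct.content, hst.static _ m hm (by simp [hms])] at this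

end Algorithm

/-! ## Call trees -/

section Calls

variable {N : ℕ} {r : Fin N → ℕ} {A : ∀ i, Algorithm S α (r i)} {callee : Fin N → S → Fin N}

/-- Termination is inherited along calls: the answer to the query is defined, and an oracle is
defined only where its objective function is. -/
theorem Calls.computes
    (objective : ∀ i e, (A i).IsExtrinsic e → IsObjective (A i) e (A (callee i e)))
    {p q : Σ i, Fin (r i) → Elem α} (h : Calls A callee p q)
    (hp : ∃ y, (A p.1).Computes p.2 y) : ∃ y, (A q.1).Computes q.2 y := by
  obtain ⟨e, he, hq⟩ := h
  obtain ⟨y, hy⟩ := hp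
  have ho := objective p.1 e hq.1
  rw [he] at ho
  obtain ⟨hb, hs⟩ := hy.isSome_of_poses hq
  obtain ⟨z, hz⟩ := Option.ne_none_iff_exists'.1 hs
  exact ⟨z, (ho.agree q.2 (ho.query p.2 hy.1 q.2 hq) hb z).1 hz⟩

theorem finite_calls {p : Σ i, Fin (r i) → Elem α} (hp : ∃ y, (A p.1).Computes p.2 y) :
    {q | Calls A callee p q}.Finite := by
  obtain ⟨y, hy⟩ := hp
  -- There is at most one call per query: the symbol determines the callee, and the arguments are
  -- the input.
  refine (hy.finite_poses.biUnion
    (t := fun l => {q | callee p.1 l.sym = q.1 ∧ l = ⟨l.sym, r q.1, q.2⟩}) fun l _ => ?_).subset ?_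
  · refine Set.Subsingleton.finite ?_
    rintro ⟨j, xs⟩ ⟨h1, h2⟩ ⟨j', xs'⟩ ⟨h1', h2'⟩
    obtain rfl : j = j' := h1.symm.trans h1'
    have := h2.symm.trans h2'
    simp only [Loc.mk.injEq, heq_eq_eq, true_and] at this
    rw [this]
  · rintro q ⟨e, he, hq⟩
    exact Set.mem_biUnion hq ⟨he, rfl⟩

/-- König's lemma, by induction on accessibility: branching is finite because termination is
inherited along calls. -/
theorem finite_callTree
    (objective : ∀ i e, (A i).IsExtrinsic e → IsObjective (A i) e (A (callee i e)))
    {p : Σ i, Fin (r i) → Elem α} (hacc : Acc (fun q p => Calls A callee p q) p)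
    (hp : ∃ y, (A p.1).Computes p.2 y) :
    {q | Relation.ReflTransGen (Calls A callee) p q}.Finite := by
  induction hacc with
  | intro p _ ih =>
    refine (((finite_calls hp).biUnion fun q hq => ih q hq (hq.computes objective hp)).insert
      p).subset fun q hq => ?_
    rcases Relation.ReflTransGen.cases_head hq with rfl | ⟨q', hq', hq⟩
    · exact Or.inl rfl
    · exact Or.inr (Set.mem_biUnion hq' hq)

end Calls

/-! ## The simulating algorithm -/

/-- The dynamic symbols of the simulating algorithm: `frame i f` is the dynamic function `f` of the
`i`-th algorithm with the number of the current run as an additional first argument; `known j` and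
`val j` hold the values of the `j`-th objective function found so far; `arg j k` is the `k`-th
argument of the current run; `inp k` and `out` are the input variables and the output variable;
`cnt` is the number of the current run; `phase` is `i + 1` during a run of the `i`-th algorithm and
`0` between runs. -/
inductive Aux (N : ℕ) (S : Type v)
  | frame (i : Fin N) (f : S)
  | known (j : Fin N)
  | val (j : Fin N)
  | arg (j : Fin N) (k : ℕ)
  | inp (k : ℕ)
  | out
  | cnt
  | phase

/-- A code of the auxiliary symbols. -/
def Aux.code {N : ℕ} : Aux N S → (ℕ × ℕ × ℕ) × Option S
  | .frame i f => ((0, i, 0), some f)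
  | .known j => ((1, j, 0), none)
  | .val j => ((2, j, 0), none)
  | .arg j k => ((3, j, k), none)
  | .inp k => ((4, k, 0), none)
  | .out => ((5, 0, 0), none)
  | .cnt => ((6, 0, 0), none)
  | .phase => ((7, 0, 0), none)

theorem Aux.code_injective {N : ℕ} : Function.Injective (Aux.code (N := N) (S := S)) := by
  intro a b h
  cases a <;> cases b <;> simp [Aux.code, Fin.val_inj] at h ⊢ <;> exact h

/-- Coding an auxiliary symbol by three numbers and at most one symbol shows that there are no more
of them than elements of `S`; removing a finite set from `S` does not change its cardinality. -/
theorem Aux.exists_embedding [Infinite S] (N : ℕ) {T : Set S} (hT : T.Finite) :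
    ∃ g : Aux N S → S, Function.Injective g ∧ ∀ a, g a ∉ T := by
  have hS : Cardinal.aleph0 ≤ Cardinal.mk S := Cardinal.aleph0_le_mk S
  have h1 : Cardinal.mk (Aux N S) ≤ Cardinal.mk S := by
    refine (Cardinal.mk_le_of_injective Aux.code_injective).trans ?_
    simp only [Cardinal.mk_prod, Cardinal.mk_option, Cardinal.lift_id, Cardinal.mk_nat,
      Cardinal.lift_aleph0, Cardinal.aleph0_mul_aleph0, Cardinal.lift_uzero]
    refine (Cardinal.mul_le_max _ _).trans (max_le (max_le hS ?_) hS)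
    exact (Cardinal.add_one_eq hS).le
  have h2 : Cardinal.mk (Tᶜ : Set S) = Cardinal.mk S :=
    Cardinal.mk_compl_of_infinite T (hT.lt_aleph0.trans_le hS)
  obtain ⟨g⟩ : Nonempty (Aux N S ↪ (Tᶜ : Set S)) := by
    rw [← h2] at h1
    exact h1
  exact ⟨fun a => g a, fun a b h => g.injective (Subtype.ext h), fun a => (g a).2⟩

/-- A mutually recursive system of algorithms with a choice of fresh symbols. -/
structure System (S : Type v) (α : Type u) (N : ℕ) [NeZero N] where
  r : Fin N → ℕ
  A : ∀ i, Algorithm S α (r i)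
  c : ArithNames S
  consistent : ∀ i j, (A i).datastructure.Consistent (A j).datastructure
  consistent_arith : ∀ i, (A i).datastructure.Consistent c.arith
  callee : Fin N → S → Fin N
  objective : ∀ i e, (A i).IsExtrinsic e → IsObjective (A i) e (A (callee i e))
  sym : Aux N S → S
  sym_injective : Function.Injective sym
  sym_fresh : ∀ a (o : Option (Fin N)),
    (o.elim c.arith fun i => (A i).datastructure).voc.mark (sym a) = none

theorem Kind.dflt_ne_atom (κ : Kind) (a : α) : κ.dflt ≠ Elem.atom a := by
  cases κ <;> simp [Kind.dflt]

theorem Kind.allows_dflt (κ : Kind) : κ.Allows (κ.dflt : Elem α) := by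
  cases κ <;> simp [Kind.dflt, Kind.Allows]

theorem Struct.Consistent.symm {X Y : Struct S α} (h : X.Consistent Y) : Y.Consistent X := by
  intro f mY mX hY hX
  obtain ⟨h1, h2⟩ := h f mX mY hX hY
  exact ⟨h1.symm, fun n xs hxs => (h2 n xs fun k => (hxs k).symm).symm⟩

namespace System

variable {N : ℕ} [NeZero N] (Y : System S α N)

/-! ### The union of the datastructures, extended by auxiliary dynamic symbols. -/

/-- The given datastructures, including arithmetic. -/
noncomputable def data (o : Option (Fin N)) : Struct S α :=
  o.elim Y.c.arith fun i => (Y.A i).datastructure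

theorem data_consistent (o o' : Option (Fin N)) : (Y.data o).Consistent (Y.data o') := by
  cases o with
  | none =>
    cases o' with
    | none =>
      intro f m m' h h'
      exact ⟨Option.some.inj (h.symm.trans h'), fun _ _ _ => rfl⟩
    | some j => exact (Y.consistent_arith j).symm
  | some i =>
    cases o' with
    | none => exact Y.consistent_arith i
    | some j => exact Y.consistent i j

theorem data_intrinsic {o : Option (Fin N)} {f : S} {m : Mark}
    (h : (Y.data o).voc.mark f = some m) : m.status = .intrinsic := by
  cases o with
  | none =>
    simp only [data, Option.elim, ArithNames.arith, ArithNames.voc] at h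
    split_ifs at h <;> obtain rfl := Option.some.inj h <;> rfl
  | some i =>
    obtain ⟨⟨m', hm', hs⟩, hm⟩ := Algorithm.mark_of_intrinsicVoc h
    obtain rfl := Option.some.inj (hm.symm.trans hm')
    exact hs

/-- The marks of the auxiliary symbols. -/
def auxMark : Aux N S → Option Mark
  | .frame i f => match (Y.A i).blank.voc.mark f with
    -- Keeping the kind ensures that the copy has the same default and the same permitted values as
    -- `f`.
    | some ⟨a, .dynamic, κ⟩ => some ⟨a + 1, .dynamic, κ⟩
    | _ => none
  | .known j => some ⟨Y.r j, .dynamic, .general⟩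
  | .val j => some ⟨Y.r j, .dynamic, .general⟩
  -- Indices range over `ℕ` so that `Aux` does not depend on the arities; the bound keeps the
  -- vocabulary finite.
  | .arg j k => if k < Y.r j then some ⟨0, .dynamic, .general⟩ else none
  | .inp k => if k < Y.r 0 then some ⟨0, .dynamic, .general⟩ else none
  | .out => some ⟨0, .dynamic, .general⟩
  | .cnt => some ⟨0, .dynamic, .numerical⟩
  | .phase => some ⟨0, .dynamic, .numerical⟩

theorem auxMark_frame {i : Fin N} {f : S} {m : Mark} (hm : (Y.A i).blank.voc.mark f = some m)
    (hs : m.status = .dynamic) :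
    Y.auxMark (.frame i f) = some ⟨m.arity + 1, .dynamic, m.kind⟩ := by
  obtain ⟨a, s, κ⟩ := m
  obtain rfl : s = .dynamic := hs
  simp [auxMark, hm]

theorem auxMark_dynamic {a : Aux N S} {m : Mark} (h : Y.auxMark a = some m) :
    m.status = .dynamic := by
  cases a with
  | frame i f =>
    simp only [auxMark] at h
    split at h
    · obtain rfl := Option.some.inj h
      rfl
    · cases h
  | arg j k => simp only [auxMark] at h; split_ifs at h; obtain rfl := Option.some.inj h; rfl
  | inp k => simp only [auxMark] at h; split_ifs at h; obtain rfl := Option.some.inj h; rfl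
  | _ => simp only [auxMark] at h; obtain rfl := Option.some.inj h; rfl

theorem finite_auxMark : {a | Y.auxMark a ≠ none}.Finite := by
  have h1 : (⋃ i, Aux.frame i '' {f | (Y.A i).blank.voc.mark f ≠ none}).Finite :=
    Set.finite_iUnion fun i => (Y.A i).blank.voc.finite.image _
  have h2 : (⋃ j, Aux.arg (S := S) j '' Set.Iio (Y.r j)).Finite :=
    Set.finite_iUnion fun j => (Set.finite_Iio _).image _
  have h3 : (Aux.inp (N := N) (S := S) '' Set.Iio (Y.r 0)).Finite := (Set.finite_Iio _).image _
  refine ((((h1.union h2).union h3).union (Set.finite_range (Aux.known (S := S)))).union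
    ((Set.finite_range (Aux.val (S := S))).union
      (Set.toFinite {Aux.out, Aux.cnt, Aux.phase}))).subset ?_
  intro a ha
  cases a with
  | frame i f =>
    refine Or.inl (Or.inl (Or.inl (Or.inl (Set.mem_iUnion.2 ⟨i, f, ?_, rfl⟩))))
    intro h
    simp [auxMark, h] at ha
  | arg j k =>
    refine Or.inl (Or.inl (Or.inl (Or.inr (Set.mem_iUnion.2 ⟨j, k, ?_, rfl⟩))))
    by_contra h
    exact ha (if_neg h)
  | inp k =>
    refine Or.inl (Or.inl (Or.inr ⟨k, ?_, rfl⟩))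
    by_contra h
    exact ha (if_neg h)
  | known j => exact Or.inl (Or.inr ⟨j, rfl⟩)
  | val j => exact Or.inr (Or.inl ⟨j, rfl⟩)
  | _ => exact Or.inr (Or.inr (by simp))

open Classical in
/-- The vocabulary of the simulating algorithm. -/
noncomputable def voc : Vocabulary S where
  mark f :=
    if h : ∃ o, (Y.data o).voc.mark f ≠ none then (Y.data h.choose).voc.mark f
    else if h : ∃ a, Y.sym a = f then Y.auxMark h.choose else none
  finite := by
    refine ((Set.finite_iUnion fun o => (Y.data o).voc.finite).union
      (Y.finite_auxMark.image Y.sym)).subset fun f hf => ?_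
    simp only [Set.mem_ofPred_eq] at hf
    split_ifs at hf with h1 h2
    · exact Or.inl (Set.mem_iUnion.2 h1)
    · exact Or.inr ⟨_, hf, h2.choose_spec⟩
    · exact (hf rfl).elim

/-- The mark in `voc` is taken from an arbitrarily chosen datastructure having the symbol;
consistency makes the choice immaterial. -/
theorem mark_data {o : Option (Fin N)} {f : S} {m : Mark} (h : (Y.data o).voc.mark f = some m) :
    Y.voc.mark f = some m := by
  have he : ∃ o, (Y.data o).voc.mark f ≠ none := ⟨o, by simp [h]⟩
  obtain ⟨m', hm'⟩ := Option.ne_none_iff_exists'.1 he.choose_spec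
  simp only [voc]
  rw [dif_pos he, hm', ((Y.data_consistent _ _) f m' m hm' h).1]

theorem data_sym (o : Option (Fin N)) (a : Aux N S) : (Y.data o).voc.mark (Y.sym a) = none :=
  Y.sym_fresh a o

theorem mark_sym (a : Aux N S) : Y.voc.mark (Y.sym a) = Y.auxMark a := by
  have he : ¬ ∃ o, (Y.data o).voc.mark (Y.sym a) ≠ none := by simp [Y.data_sym]
  have he' : ∃ b, Y.sym b = Y.sym a := ⟨a, rfl⟩
  simp only [voc]
  rw [dif_neg he, dif_pos he', Y.sym_injective he'.choose_spec]

theorem mark_cases {f : S} {m : Mark} (h : Y.voc.mark f = some m) :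
    (∃ o, (Y.data o).voc.mark f = some m) ∨ ∃ a, f = Y.sym a ∧ Y.auxMark a = some m := by
  simp only [voc] at h
  split_ifs at h with h1 h2
  · exact Or.inl ⟨_, h⟩
  · exact Or.inr ⟨_, h2.choose_spec.symm, h⟩

theorem mark_dynamic {f : S} {m : Mark} (h : Y.voc.mark f = some m) (hs : m.status = .dynamic) :
    ∃ a, f = Y.sym a ∧ Y.auxMark a = some m := by
  rcases Y.mark_cases h with ⟨o, ho⟩ | h
  · rw [Y.data_intrinsic ho] at hs
    cases hs
  · exact h

/-- The base set of the simulating algorithm. -/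
def base : Set (Elem α) := ⋃ o, (Y.data o).base

theorem data_base_subset (o : Option (Fin N)) : (Y.data o).base ⊆ Y.base :=
  Set.subset_iUnion (fun o => (Y.data o).base) o

theorem base_subset (i : Fin N) : (Y.A i).blank.base ⊆ Y.base := Y.data_base_subset (some i)

theorem not_atom_mem {e : Elem α} (h : ∀ a, e ≠ .atom a) : e ∈ Y.base :=
  Y.data_base_subset none h

open Classical in
/-- The common part of the initial states of the simulating algorithm. -/
noncomputable def blank : Struct S α where
  voc := Y.voc
  base := Y.base
  fn f n xs :=
    if h : ∃ o, (∃ m, (Y.data o).voc.mark f = some m ∧ m.arity = n) ∧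
      ∀ k, xs k ∈ (Y.data o).base then (Y.data h.choose).fn f n xs
    else if ∀ k, xs k ∈ Y.base then
      (Y.voc.mark f).bind fun m => if m.arity = n then some m.kind.dflt else none
    else none
  tt_mem := Y.not_atom_mem (by simp)
  ff_mem := Y.not_atom_mem (by simp)
  nil_mem := Y.not_atom_mem (by simp)
  dflt_mem f m _ := Y.not_atom_mem m.kind.dflt_ne_atom
  fn_mem f n xs y h := by
    split_ifs at h with h1 h2
    · obtain ⟨m, hm, ha, hk, hx, hy⟩ := (Y.data _).fn_mem f n xs y h
      exact ⟨m, Y.mark_data hm, ha, hk, fun k => Y.data_base_subset _ (hx k),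
        Y.data_base_subset _ hy⟩
    · obtain ⟨m, hm, h⟩ := Option.bind_eq_some_iff.1 h
      split_ifs at h with ha
      obtain rfl := Option.some.inj h
      exact ⟨m, hm, ha, m.kind.allows_dflt, h2, Y.not_atom_mem m.kind.dflt_ne_atom⟩

/-- The same independence of the choice for values: the tuple lies in both datastructures, which
agree on joint elements. -/
theorem blank_data {o : Option (Fin N)} {f : S} {m : Mark}
    (h : (Y.data o).voc.mark f = some m) {xs : Fin m.arity → Elem α}
    (hxs : ∀ k, xs k ∈ (Y.data o).base) :
    Y.blank.fn f m.arity xs = (Y.data o).fn f m.arity xs := by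
  have he : ∃ o, (∃ m', (Y.data o).voc.mark f = some m' ∧ m'.arity = m.arity) ∧
    ∀ k, xs k ∈ (Y.data o).base := ⟨o, ⟨m, h, rfl⟩, hxs⟩
  obtain ⟨⟨m', hm', -⟩, hx'⟩ := he.choose_spec
  simp only [blank]
  rw [dif_pos he]
  exact (Y.data_consistent _ _ f m' m hm' h).2 _ _ fun k => ⟨hx' k, hxs k⟩

theorem blank_dflt {f : S} {m : Mark} (h : Y.voc.mark f = some m) {xs : Fin m.arity → Elem α}
    (hxs : ∀ k, xs k ∈ Y.base)
    (ho : ∀ o, (Y.data o).voc.mark f = some m → ∃ k, xs k ∉ (Y.data o).base) :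
    Y.blank.fn f m.arity xs = some m.kind.dflt := by
  simp only [blank]
  rw [dif_neg, if_pos hxs, h]
  · simp
  · rintro ⟨o, ⟨m', hm', -⟩, hx⟩
    obtain rfl := Option.some.inj (h.symm.trans (Y.mark_data hm'))
    obtain ⟨k, hk⟩ := ho o hm'
    exact hk (hx k)

theorem blank_aux {a : Aux N S} {m : Mark} (h : Y.auxMark a = some m)
    {xs : Fin m.arity → Elem α} (hxs : ∀ k, xs k ∈ Y.base) :
    Y.blank.fn (Y.sym a) m.arity xs = some m.kind.dflt :=
  Y.blank_dflt ((Y.mark_sym a).trans h) hxs fun o ho => by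
    rw [Y.data_sym] at ho
    cases ho

/-! ### The program -/

/-- An auxiliary variable as a term. -/
def var (a : Aux N S) : Term S := .app (Y.sym a) 0 Fin.elim0

/-- The assignment to an auxiliary variable. -/
def setVar (a : Aux N S) (t : Term S) : Rule S := .assign (Y.sym a) 0 Fin.elim0 t

/-- A number as a term. -/
def numeral : ℕ → Term S
  | 0 => .app Y.c.zero 0 Fin.elim0
  | n + 1 => .app Y.c.succ 1 fun _ => numeral n

/-- The number of the next run. -/
def nextCnt : Term S := .app Y.c.succ 1 fun _ => Y.var .cnt

/-- Parallel execution of a family of rules. -/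
def parAll {n : ℕ} (R : Fin n → Rule S) (R₀ : Rule S) : Rule S :=
  (List.finRange n).foldr (fun k P => .par (R k) P) R₀

/-- Start a run of the `j`-th algorithm on the arguments `ts`. -/
def call (j : Fin N) (ts : ℕ → Term S) : Rule S :=
  parAll (n := Y.r j) (fun k => .par (Y.setVar (.arg j k) (ts k))
      (.assign (Y.sym (.frame j ((Y.A j).input k))) 1 (fun _ => Y.nextCnt) (ts k)))
    (.par (Y.setVar .cnt Y.nextCnt) (Y.setVar .phase (Y.numeral (j + 1))))

open Classical in
/-- The translation of terms of the `i`-th algorithm. -/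
noncomputable def tr (i : Fin N) : Term S → Term S
  | .app f n ts =>
    if (Y.A i).IsExtrinsic f then
      .app (Y.sym (.val (Y.callee i f))) n fun k => tr i (ts k)
    else if ∃ m, (Y.A i).blank.voc.mark f = some m ∧ m.status = .dynamic then
      .app (Y.sym (.frame i f)) (n + 1) (Fin.cons (Y.var .cnt) fun k => tr i (ts k))
    else .app f n fun k => tr i (ts k)
  | .tt => .tt
  | .ff => .ff
  | .nil => .nil
  | .eq s t => .eq (tr i s) (tr i t)
  | .not t => .not (tr i t)
  | .and s t => .and (tr i s) (tr i t)
  | .or s t => .or (tr i s) (tr i t)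
  | .ite c s t => .ite (tr i c) (tr i s) (tr i t)

/-- The translation of rules of the `i`-th algorithm. -/
noncomputable def trRule (i : Fin N) : Rule S → Rule S
  | .assign f n ts t =>
    .assign (Y.sym (.frame i f)) (n + 1) (Fin.cons (Y.var .cnt) fun k => Y.tr i (ts k)) (Y.tr i t)
  -- The translation of a Boolean term need not be Boolean, as a relational oracle becomes the
  -- general symbol `val`; an equation always is.
  | .cond b P Q => .cond (.eq (Y.tr i b) .tt) (trRule i P) (trRule i Q)
  | .par P Q => .par (trRule i P) (trRule i Q)

/-- A term which says that a rule of the `i`-th algorithm has only trivial updates. -/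
noncomputable def stable (i : Fin N) : Rule S → Term S
  | .assign f n ts t =>
    .eq (.app (Y.sym (.frame i f)) (n + 1) (Fin.cons (Y.var .cnt) fun k => Y.tr i (ts k)))
      (Y.tr i t)
  | .cond b P Q => .ite (Y.tr i b) (stable i P) (stable i Q)
  | .par P Q => .and (stable i P) (stable i Q)

open Classical in
/-- Start a run for the first query in the evaluation of a term whose answer is not yet known; if
there is no such query, execute `K`. -/
noncomputable def guard (i : Fin N) : Term S → Rule S → Rule S
  | .app f n ts, K => (List.finRange n).foldr (fun k R => guard i (ts k) R)
    (if (Y.A i).IsExtrinsic f then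
      .cond (.eq (.app (Y.sym (.known (Y.callee i f))) n fun k => Y.tr i (ts k)) .tt) K
        (Y.call (Y.callee i f) fun k => if h : k < n then Y.tr i (ts ⟨k, h⟩) else .nil)
    else K)
  | .tt, K | .ff, K | .nil, K => K
  | .not t, K => guard i t K
  | .eq s t, K | .and s t, K | .or s t, K => guard i s (guard i t K)
  | .ite c s t, K => guard i c (.cond (.eq (Y.tr i c) .tt) (guard i s K)
    (.cond (.eq (Y.tr i c) .ff) (guard i t K) K))

/-- Start a run for the first query in the execution of a rule whose answer is not yet known; if
there is no such query, execute `K`. -/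
noncomputable def guardRule (i : Fin N) : Rule S → Rule S → Rule S
  | .assign _ n ts t, K => (List.finRange n).foldr (fun k R => Y.guard i (ts k) R) (Y.guard i t K)
  | .cond b P Q, K =>
    Y.guard i b (.cond (.eq (Y.tr i b) .tt) (guardRule i P K) (guardRule i Q K))
  | .par P Q, K => guardRule i P (guardRule i Q K)

/-- Record the result of the current run. -/
def finish (i : Fin N) : Rule S :=
  .par (.assign (Y.sym (.known i)) (Y.r i) (fun k => Y.var (.arg i k)) .tt)
    (.par (.assign (Y.sym (.val i)) (Y.r i) (fun k => Y.var (.arg i k))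
      (.app (Y.sym (.frame i (Y.A i).output)) 1 fun _ => Y.var .cnt))
      (Y.setVar .phase (Y.numeral 0)))

/-- A step of a run of the `i`-th algorithm. -/
noncomputable def run (i : Fin N) : Rule S :=
  Y.guardRule i (Y.A i).program
    (.cond (.eq (Y.stable i (Y.A i).program) .tt) (Y.finish i) (Y.trRule i (Y.A i).program))

/-- A step between runs. -/
def idle : Rule S :=
  .cond (.eq (.app (Y.sym (.known 0)) (Y.r 0) fun k => Y.var (.inp k)) .tt)
    (Y.setVar .out (.app (Y.sym (.val 0)) (Y.r 0) fun k => Y.var (.inp k)))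
    (Y.call 0 fun k => Y.var (.inp k))

/-- The program of the simulating algorithm. -/
noncomputable def program : Rule S :=
  .cond (.eq (Y.var .phase) (Y.numeral 0)) Y.idle
    ((List.finRange N).foldr
      (fun (i : Fin N) R => .cond (.eq (Y.var .phase) (Y.numeral (i + 1))) (Y.run i) R)
      -- Rules have no skip, so a trivial assignment closes the case distinction. It is never
      -- executed during a run, whose phase is some `i + 1`.
      (Y.setVar .phase (Y.var .phase)))

/-! ### Well-formedness -/

theorem voc_zero : Y.voc.mark Y.c.zero = some ⟨0, .intrinsic, .numerical⟩ :=
  Y.mark_data (o := none) (by simp [data, ArithNames.arith, ArithNames.voc])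

theorem data_succ : (Y.data none).voc.mark Y.c.succ = some ⟨1, .intrinsic, .numerical⟩ := by
  have hd := Y.c.distinct
  simp only [List.nodup_cons, List.mem_cons, not_or] at hd
  simp [data, ArithNames.arith, ArithNames.voc, Ne.symm hd.1.1]

theorem numeral_wf (n : ℕ) : (Y.numeral n).WF Y.voc := by
  induction n with
  | zero => exact ⟨⟨_, Y.voc_zero, rfl⟩, fun k => k.elim0⟩
  | succ n ih => exact ⟨⟨_, Y.mark_data Y.data_succ, rfl⟩, fun _ => ih⟩

theorem app_wf {a : Aux N S} {m : Mark} (h : Y.auxMark a = some m) {ts : Fin m.arity → Term S}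
    (hts : ∀ k, (ts k).WF Y.voc) : (Term.app (Y.sym a) m.arity ts).WF Y.voc :=
  ⟨⟨m, (Y.mark_sym a).trans h, rfl⟩, hts⟩

theorem assign_wf {a : Aux N S} {m : Mark} (h : Y.auxMark a = some m) {ts : Fin m.arity → Term S}
    (hts : ∀ k, (ts k).WF Y.voc) {t : Term S} (ht : t.WF Y.voc) :
    (Rule.assign (Y.sym a) m.arity ts t).WF Y.voc :=
  ⟨⟨m, (Y.mark_sym a).trans h, Y.auxMark_dynamic h, rfl⟩, hts, ht⟩

theorem var_wf {a : Aux N S} {κ : Kind} (h : Y.auxMark a = some ⟨0, .dynamic, κ⟩) :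
    (Y.var a).WF Y.voc := Y.app_wf h fun k => k.elim0

theorem setVar_wf {a : Aux N S} {κ : Kind} (h : Y.auxMark a = some ⟨0, .dynamic, κ⟩)
    {t : Term S} (ht : t.WF Y.voc) : (Y.setVar a t).WF Y.voc :=
  Y.assign_wf h (fun k => k.elim0) ht

theorem nextCnt_wf : Y.nextCnt.WF Y.voc :=
  ⟨⟨_, Y.mark_data Y.data_succ, rfl⟩, fun _ => Y.var_wf rfl⟩

theorem foldr_wf {β : Type*} {V : Vocabulary S} {g : β → Rule S → Rule S} {R₀ : Rule S}
    (l : List β) (hg : ∀ b ∈ l, ∀ R : Rule S, R.WF V → (g b R).WF V) (h₀ : R₀.WF V) :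
    (l.foldr g R₀).WF V := by
  induction l with
  | nil => exact h₀
  | cons b l ih =>
    exact hg b (by simp) _ (ih fun b' hb' => hg b' (List.mem_cons_of_mem _ hb'))

theorem auxMark_arg {j : Fin N} (k : Fin (Y.r j)) :
    Y.auxMark (.arg j k) = some ⟨0, .dynamic, .general⟩ := by simp [auxMark]

theorem auxMark_inp (k : Fin (Y.r 0)) :
    Y.auxMark (.inp k) = some ⟨0, .dynamic, .general⟩ := by simp [auxMark]

theorem auxMark_input {j : Fin N} (k : Fin (Y.r j)) : ∃ κ,
    (Y.A j).blank.voc.mark ((Y.A j).input k) = some ⟨0, .dynamic, κ⟩ ∧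
    Y.auxMark (.frame j ((Y.A j).input k)) = some ⟨1, .dynamic, κ⟩ := by
  obtain ⟨⟨a, s, κ⟩, hm, hs, ha⟩ := (Y.A j).input_dynamic k
  obtain rfl : a = 0 := ha
  obtain rfl : s = .dynamic := hs
  exact ⟨κ, hm, Y.auxMark_frame hm rfl⟩

theorem auxMark_output (j : Fin N) : ∃ κ,
    (Y.A j).blank.voc.mark (Y.A j).output = some ⟨0, .dynamic, κ⟩ ∧
    Y.auxMark (.frame j (Y.A j).output) = some ⟨1, .dynamic, κ⟩ := by
  obtain ⟨⟨a, s, κ⟩, hm, hs, ha⟩ := (Y.A j).output_dynamic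
  obtain rfl : a = 0 := ha
  obtain rfl : s = .dynamic := hs
  exact ⟨κ, hm, Y.auxMark_frame hm rfl⟩

theorem call_wf {j : Fin N} {ts : ℕ → Term S} (h : ∀ k < Y.r j, (ts k).WF Y.voc) :
    (Y.call j ts).WF Y.voc := by
  refine foldr_wf _ (fun k _ R hR => ⟨⟨?_, ?_⟩, hR⟩) ⟨?_, ?_⟩
  · exact Y.setVar_wf (Y.auxMark_arg k) (h k k.2)
  · obtain ⟨κ, -, hκ⟩ := Y.auxMark_input k
    exact Y.assign_wf hκ (fun _ => Y.nextCnt_wf) (h k k.2)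
  · exact Y.setVar_wf rfl Y.nextCnt_wf
  · exact Y.setVar_wf rfl (Y.numeral_wf _)

theorem cons_wf {n : ℕ} {ts : Fin n → Term S} (h : ∀ k, (ts k).WF Y.voc) (k : Fin (n + 1)) :
    ((Fin.cons (Y.var .cnt) ts : Fin (n + 1) → Term S) k).WF Y.voc := by
  refine Fin.cases ?_ (fun k => ?_) k
  · exact Y.var_wf rfl
  · exact h k

theorem callee_arity {i : Fin N} {e : S} {m : Mark} (he : (Y.A i).IsExtrinsic e)
    (hm : (Y.A i).blank.voc.mark e = some m) : m.arity = Y.r (Y.callee i e) :=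
  (Y.objective i e he).arity m hm

theorem data_of_static {i : Fin N} {f : S} {m : Mark} (hm : (Y.A i).blank.voc.mark f = some m)
    (he : ¬ (Y.A i).IsExtrinsic f)
    (hd : ¬ ∃ m, (Y.A i).blank.voc.mark f = some m ∧ m.status = .dynamic) :
    (Y.A i).IsIntrinsic f ∧ (Y.data (some i)).voc.mark f = some m := by
  have hi : (Y.A i).IsIntrinsic f := by
    refine ⟨m, hm, ?_⟩
    rcases hs : m.status
    · exact (hd ⟨m, hm, hs⟩).elim
    · rfl
    · exact (he ⟨m, hm, hs⟩).elim
  exact ⟨hi, by simp [data, Algorithm.datastructure, Algorithm.intrinsicVoc, hi, hm]⟩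

theorem tr_wf {i : Fin N} {t : Term S} (h : t.WF (Y.A i).blank.voc) : (Y.tr i t).WF Y.voc := by
  induction t with
  | app f n ts ih =>
    obtain ⟨⟨m, hm, rfl⟩, hts⟩ := h
    simp only [tr]
    split_ifs with he hd
    · exact ⟨⟨_, Y.mark_sym _, (Y.callee_arity he hm).symm⟩, fun k => ih k (hts k)⟩
    · obtain ⟨m', hm', hs⟩ := hd
      obtain rfl := Option.some.inj (hm.symm.trans hm')
      exact Y.app_wf (Y.auxMark_frame hm hs) (Y.cons_wf fun k => ih k (hts k))
    · exact ⟨⟨m, Y.mark_data (Y.data_of_static hm he hd).2, rfl⟩, fun k => ih k (hts k)⟩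
  | tt => trivial
  | ff => trivial
  | nil => trivial
  | not t ih => exact ih h
  | eq s t ihs iht => exact ⟨ihs h.1, iht h.2⟩
  | and s t ihs iht => exact ⟨ihs h.1, iht h.2⟩
  | or s t ihs iht => exact ⟨ihs h.1, iht h.2⟩
  | ite c s t ihc ihs iht => exact ⟨ihc h.1, ihs h.2.1, iht h.2.2⟩

theorem trRule_wf {i : Fin N} {R : Rule S} (h : R.WF (Y.A i).blank.voc) :
    (Y.trRule i R).WF Y.voc := by
  induction R with
  | assign f n ts t =>
    obtain ⟨⟨m, hm, hs, rfl⟩, hts, ht⟩ := h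
    exact Y.assign_wf (Y.auxMark_frame hm hs) (Y.cons_wf fun k => Y.tr_wf (hts k)) (Y.tr_wf ht)
  | cond b P Q ihP ihQ => exact ⟨⟨Y.tr_wf h.1, trivial⟩, trivial, ihP h.2.2.1, ihQ h.2.2.2⟩
  | par P Q ihP ihQ => exact ⟨ihP h.1, ihQ h.2⟩

theorem stable_wf {i : Fin N} {R : Rule S} (h : R.WF (Y.A i).blank.voc) :
    (Y.stable i R).WF Y.voc := by
  induction R with
  | assign f n ts t =>
    obtain ⟨⟨m, hm, hs, rfl⟩, hts, ht⟩ := h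
    exact ⟨Y.app_wf (Y.auxMark_frame hm hs) (Y.cons_wf fun k => Y.tr_wf (hts k)), Y.tr_wf ht⟩
  | cond b P Q ihP ihQ => exact ⟨Y.tr_wf h.1, ihP h.2.2.1, ihQ h.2.2.2⟩
  | par P Q ihP ihQ => exact ⟨ihP h.1, ihQ h.2⟩

theorem guard_wf {i : Fin N} {t : Term S} (h : t.WF (Y.A i).blank.voc) {K : Rule S}
    (hK : K.WF Y.voc) : (Y.guard i t K).WF Y.voc := by
  induction t generalizing K with
  | app f n ts ih =>
    obtain ⟨⟨m, hm, rfl⟩, hts⟩ := h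
    simp only [guard]
    refine foldr_wf _ (fun k _ R hR => ih k (hts k) hR) ?_
    split_ifs with he
    · refine ⟨⟨⟨⟨_, Y.mark_sym _, (Y.callee_arity he hm).symm⟩, fun k => Y.tr_wf (hts k)⟩,
        trivial⟩, trivial, hK, Y.call_wf fun k _ => ?_⟩
      split_ifs
      · exact Y.tr_wf (hts _)
      · trivial
    · exact hK
  | tt => exact hK
  | ff => exact hK
  | nil => exact hK
  | not t ih => exact ih h hK
  | eq s t ihs iht => exact ihs h.1 (iht h.2 hK)
  | and s t ihs iht => exact ihs h.1 (iht h.2 hK)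
  | or s t ihs iht => exact ihs h.1 (iht h.2 hK)
  | ite c s t ihc ihs iht =>
    exact ihc h.1 ⟨⟨Y.tr_wf h.1, trivial⟩, trivial, ihs h.2.1 hK, ⟨Y.tr_wf h.1, trivial⟩, trivial,
      iht h.2.2 hK, hK⟩

theorem guardRule_wf {i : Fin N} {R : Rule S} (h : R.WF (Y.A i).blank.voc) {K : Rule S}
    (hK : K.WF Y.voc) : (Y.guardRule i R K).WF Y.voc := by
  induction R generalizing K with
  | assign f n ts t =>
    exact foldr_wf _ (fun k _ R hR => Y.guard_wf (h.2.1 k) hR) (Y.guard_wf h.2.2 hK)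
  | cond b P Q ihP ihQ => exact Y.guard_wf h.1 ⟨⟨Y.tr_wf h.1, trivial⟩, trivial,
      ihP h.2.2.1 hK, ihQ h.2.2.2 hK⟩
  | par P Q ihP ihQ => exact ihP h.1 (ihQ h.2 hK)

theorem finish_wf (i : Fin N) : (Y.finish i).WF Y.voc := by
  obtain ⟨κ, -, hκ⟩ := Y.auxMark_output i
  exact ⟨Y.assign_wf (m := ⟨Y.r i, .dynamic, .general⟩) rfl
      (fun k => Y.var_wf (Y.auxMark_arg k)) trivial,
    Y.assign_wf (m := ⟨Y.r i, .dynamic, .general⟩) rfl (fun k => Y.var_wf (Y.auxMark_arg k))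
      (Y.app_wf hκ fun _ => Y.var_wf rfl),
    Y.setVar_wf rfl (Y.numeral_wf 0)⟩

theorem program_wf : Y.program.WF Y.voc := by
  refine ⟨⟨Y.var_wf rfl, Y.numeral_wf 0⟩, trivial, ⟨⟨?_, trivial⟩, trivial, ?_, ?_⟩,
    foldr_wf _ (fun (i : Fin N) _ R hR => ⟨⟨Y.var_wf rfl, Y.numeral_wf _⟩, trivial, ?_, hR⟩)
      (Y.setVar_wf rfl (Y.var_wf rfl))⟩
  · exact Y.app_wf (m := ⟨Y.r 0, .dynamic, .general⟩) rfl fun k => Y.var_wf (Y.auxMark_inp k)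
  · exact Y.setVar_wf rfl (Y.app_wf (m := ⟨Y.r 0, .dynamic, .general⟩) rfl
      fun k => Y.var_wf (Y.auxMark_inp k))
  · refine Y.call_wf fun k hk => Y.var_wf (κ := .general) (by simp [auxMark, hk])
  · have h := (Y.A i).program_wf
    exact Y.guardRule_wf h ⟨⟨Y.stable_wf h, trivial⟩, trivial, Y.finish_wf i, Y.trRule_wf h⟩

/-! ### The simulating algorithm, its datastructure and its arithmetic. -/

/-- The simulating algorithm. -/
noncomputable def sim : Algorithm S α (Y.r 0) where
  blank := Y.blank
  uninformative f m hm hs xs hxs := by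
    obtain ⟨a, rfl, ha⟩ := Y.mark_dynamic hm hs
    exact Y.blank_aux ha hxs
  program := Y.program
  program_wf := Y.program_wf
  input k := Y.sym (.inp k)
  input_injective k l h := by simpa [Fin.val_inj] using Y.sym_injective h
  input_dynamic k := ⟨_, (Y.mark_sym _).trans (Y.auxMark_inp k), rfl, rfl⟩
  output := Y.sym .out
  output_dynamic := ⟨_, Y.mark_sym _, rfl, rfl⟩
  output_ne_input k h := by cases Y.sym_injective h
  dom := (Y.A 0).dom
  dom_nonempty := (Y.A 0).dom_nonempty
  dom_mem x hx k := by
    refine ⟨Y.base_subset 0 ((Y.A 0).dom_mem x hx k).1, fun m hm => ?_⟩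
    obtain rfl := Option.some.inj (hm.symm.trans ((Y.mark_sym _).trans (Y.auxMark_inp k)))
    trivial

theorem sim_not_isExtrinsic (e : S) : ¬ Y.sim.IsExtrinsic e := by
  rintro ⟨m, hm, hs⟩
  rcases Y.mark_cases hm with ⟨o, ho⟩ | ⟨a, -, ha⟩
  · rw [Y.data_intrinsic ho] at hs
    cases hs
  · rw [Y.auxMark_dynamic ha] at hs
    cases hs

theorem sim_isIntrinsic_iff {f : S} :
    Y.sim.IsIntrinsic f ↔ ∃ o m, (Y.data o).voc.mark f = some m := by
  constructor
  · rintro ⟨m, hm, hs⟩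
    rcases Y.mark_cases hm with ⟨o, ho⟩ | ⟨a, -, ha⟩
    · exact ⟨o, m, ho⟩
    · rw [Y.auxMark_dynamic ha] at hs
      cases hs
  · rintro ⟨o, m, h⟩
    exact ⟨m, Y.mark_data h, Y.data_intrinsic h⟩

theorem sim_datastructure : IsUnion Y.data Y.sim.datastructure := by
  have hv : ∀ f m, Y.sim.datastructure.voc.mark f = some m ↔
      ∃ o, (Y.data o).voc.mark f = some m := by
    intro f m
    constructor
    · intro h
      obtain ⟨hi, hm⟩ := Algorithm.mark_of_intrinsicVoc h
      obtain ⟨o, m', h'⟩ := Y.sim_isIntrinsic_iff.1 hi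
      obtain rfl := Option.some.inj (hm.symm.trans (Y.mark_data h'))
      exact ⟨o, h'⟩
    · rintro ⟨o, h⟩
      exact (if_pos (Y.sim_isIntrinsic_iff.2 ⟨o, m, h⟩)).trans (Y.mark_data h)
  refine ⟨hv, rfl, fun o f m h xs hxs => ?_, fun f m h xs hxs ho => ?_⟩
  · exact (if_pos (Y.sim_isIntrinsic_iff.2 ⟨o, m, h⟩)).trans (Y.blank_data h hxs)
  · obtain ⟨o, h⟩ := (hv f m).1 h
    exact (if_pos (Y.sim_isIntrinsic_iff.2 ⟨o, m, h⟩)).trans (Y.blank_dflt (Y.mark_data h) hxs ho)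

theorem sim_isNumerical : Y.sim.IsNumerical := by
  refine ⟨Y.c, fun x _ X hX => ?_⟩
  have hst := hX.isState
  refine ⟨fun f m h => ?_, ?_, fun f m h xs hxs => ?_⟩
  · rw [hst.voc]
    exact Y.mark_data (o := none) h
  · rw [hst.base]
    exact Y.data_base_subset none
  · rw [hst.static f m (Y.mark_data (o := none) h)
      (by rw [Y.data_intrinsic (o := none) h]; simp)]
    exact Y.blank_data (o := none) h hxs

end System

/-! ### Update sets of composite rules. -/

theorem collect_cons {n : ℕ} (a : Elem α) (v : Fin n → Option (Elem α)) :
    collect (Fin.cons (some a) v : Fin (n + 1) → Option (Elem α)) =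
      (collect v).map fun xs => Fin.cons a xs := by
  rcases h : collect v with _ | xs
  · obtain ⟨k, hk⟩ := collect_eq_none.1 h
    exact collect_eq_none.2 ⟨k.succ, hk⟩
  · refine collect_eq_some.2 fun k => Fin.cases rfl (fun k => ?_) k
    exact collect_eq_some.1 h k

theorem Rule.assign_updates {X : Struct S α} {f : S} {n : ℕ} {ts : Fin n → Term S}
    {xs : Fin n → Elem α} {t : Term S} {y : Elem α} (h : ∀ k, (ts k).eval X = some (xs k))
    (ht : t.eval X = some y) : (Rule.assign f n ts t).updates X = some {(⟨f, n, xs⟩, y)} := by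
  rw [Rule.updates, collect_eq_some.2 h, ht]
  rfl

theorem Rule.cond_eq_updates {X : Struct S α} {s t : Term S} {a b : Elem α} {P Q : Rule S}
    (hs : s.eval X = some a) (ht : t.eval X = some b) :
    (a = b → (Rule.cond (.eq s t) P Q).updates X = P.updates X) ∧
    (a ≠ b → (Rule.cond (.eq s t) P Q).updates X = Q.updates X) := by
  constructor <;> intro h <;> simp [Rule.updates, Term.eval, hs, ht, h]

theorem Rule.cond_eq_updates_none {X : Struct S α} {s t : Term S} {P Q : Rule S}
    (hs : s.eval X = none) : (Rule.cond (.eq s t) P Q).updates X = none := by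
  simp [Rule.updates, Term.eval, hs]

theorem Rule.par_updates {X : Struct S α} {P Q : Rule S} {D E : Set (Loc S α × Elem α)}
    (hP : P.updates X = some D) (hQ : Q.updates X = some E) :
    (Rule.par P Q).updates X = some (D ∪ E) := by
  rw [Rule.updates, hP, hQ]
  rfl

/-- The first argument of a location. -/
def Loc.head (l : Loc S α) : Option (Elem α) :=
  if h : 0 < l.arity then some (l.args ⟨0, h⟩) else none

theorem Struct.IsUpdate.fn {X Y : Struct S α} {D : Set (Loc S α × Elem α)} (h : X.IsUpdate D Y)
    {f : S} {n : ℕ} {xs : Fin n → Elem α} {y : Elem α} (hy : (⟨f, n, xs⟩, y) ∈ D) :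
    Y.fn f n xs = some y := h.content _ hy

theorem Struct.IsUpdate.fn_other {X Y : Struct S α} {D : Set (Loc S α × Elem α)}
    (h : X.IsUpdate D Y) {f : S} {n : ℕ} {xs : Fin n → Elem α}
    (hD : ∀ p ∈ D, p.1 ≠ ⟨f, n, xs⟩) : Y.fn f n xs = X.fn f n xs :=
  h.other ⟨f, n, xs⟩ fun _ hy => hD _ hy rfl

namespace System

variable {N : ℕ} [NeZero N] (Y : System S α N)

theorem parAll_updates {X : Struct S α} {n : ℕ} {R : Fin n → Rule S} {R₀ : Rule S}
    {D : Fin n → Set (Loc S α × Elem α)} {D₀ : Set (Loc S α × Elem α)}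
    (h : ∀ k, (R k).updates X = some (D k)) (h₀ : R₀.updates X = some D₀) :
    (parAll R R₀).updates X = some ({p | ∃ k, p ∈ D k} ∪ D₀) := by
  have key : ∀ l : List (Fin n), (l.foldr (fun k P => Rule.par (R k) P) R₀).updates X =
      some ({p | ∃ k ∈ l, p ∈ D k} ∪ D₀) := by
    intro l
    induction l with
    | nil => simp [h₀]
    | cons a l ih =>
      rw [List.foldr_cons, Rule.par_updates (h a) ih]
      congr 1
      ext p
      simp [or_assoc]
  rw [parAll]
  simpa using key (List.finRange n)

/-! ### Evaluation in states of the simulating algorithm -/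

variable {Y}

theorem numeral_eval {Z : Struct S α} (hZ : Y.sim.IsState Z) (n : ℕ) :
    (Y.numeral n).eval Z = some (.num n) := by
  induction n with
  | zero =>
    have hm : (Y.data none).voc.mark Y.c.zero = some ⟨0, .intrinsic, .numerical⟩ := by
      simp [data, ArithNames.arith, ArithNames.voc]
    rw [numeral, Term.eval_app_of (xs := Fin.elim0) fun k => k.elim0,
      hZ.static _ _ (Y.mark_data hm) (by simp)]
    refine (Y.blank_data hm (xs := Fin.elim0) fun k => k.elim0).trans ?_
    simp [data, ArithNames.arith, ArithNames.fn]
  | succ n ih =>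
    rw [numeral, Term.eval_app_of (xs := fun _ => .num n) fun _ => ih,
      hZ.static _ _ (Y.mark_data Y.data_succ) (by simp)]
    refine (Y.blank_data Y.data_succ (xs := fun _ => .num n) fun _ => ?_).trans ?_
    · simp [data, ArithNames.arith]
    · simp [data, ArithNames.arith, ArithNames.fn, Elem.succ]

theorem var_eval (Z : Struct S α) (a : Aux N S) :
    (Y.var a).eval Z = Z.fn (Y.sym a) 0 ![] :=
  Term.eval_app_of fun k => k.elim0

theorem nextCnt_eval {Z : Struct S α} (hZ : Y.sim.IsState Z) {n : ℕ}
    (hn : Z.fn (Y.sym .cnt) 0 ![] = some (.num n)) : Y.nextCnt.eval Z = some (.num (n + 1)) := by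
  rw [← var_eval] at hn
  have := numeral_eval hZ (n + 1)
  rwa [numeral, Term.eval_app_of (xs := fun _ => .num n) fun _ => numeral_eval hZ n,
    ← Term.eval_app_of (ts := fun _ => Y.var .cnt) fun _ => hn] at this

theorem setVar_updates {Z : Struct S α} {a : Aux N S} {t : Term S} {y : Elem α}
    (h : t.eval Z = some y) : (Y.setVar a t).updates Z = some {(⟨Y.sym a, 0, ![]⟩, y)} :=
  Rule.assign_updates (fun k => k.elim0) h

theorem aux_total {Z : Struct S α} (hZ : Y.sim.IsState Z) {a : Aux N S} {m : Mark}
    (h : Y.auxMark a = some m) {xs : Fin m.arity → Elem α} (hxs : ∀ k, xs k ∈ Y.base) :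
    ∃ y, Z.fn (Y.sym a) m.arity xs = some y :=
  Option.ne_none_iff_exists'.1
    (hZ.total _ m ((Y.mark_sym a).trans h) (Y.auxMark_dynamic h) xs hxs)

variable (Y) in
/-- The updates of starting run `n + 1`, a run of the `j`-th algorithm on `xs`. -/
def callSet (n : ℕ) (j : Fin N) (xs : Fin (Y.r j) → Elem α) : Set (Loc S α × Elem α) :=
  {p | ∃ k : Fin (Y.r j), p ∈ ({(⟨Y.sym (.arg j k), 0, ![]⟩, xs k)} ∪
    {(⟨Y.sym (.frame j ((Y.A j).input k)), 1, fun _ => .num (n + 1)⟩, xs k)} :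
      Set (Loc S α × Elem α))} ∪
  ({(⟨Y.sym .cnt, 0, ![]⟩, .num (n + 1))} ∪ {(⟨Y.sym .phase, 0, ![]⟩, .num (j + 1))})

theorem mem_callSet {n : ℕ} {j : Fin N} {xs : Fin (Y.r j) → Elem α} {p : Loc S α × Elem α} :
    p ∈ Y.callSet n j xs ↔ (∃ k : Fin (Y.r j), p = (⟨Y.sym (.arg j k), 0, ![]⟩, xs k)) ∨
      (∃ k, p = (⟨Y.sym (.frame j ((Y.A j).input k)), 1, fun _ => .num (n + 1)⟩, xs k)) ∨
      p = (⟨Y.sym .cnt, 0, ![]⟩, .num (n + 1)) ∨ p = (⟨Y.sym .phase, 0, ![]⟩, .num (j + 1)) := by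
  simp only [callSet, Set.mem_union, Set.mem_singleton_iff, Set.mem_ofPred_eq, exists_or, or_assoc]

theorem call_updates {Z : Struct S α} (hZ : Y.sim.IsState Z) {n : ℕ}
    (hn : Z.fn (Y.sym .cnt) 0 ![] = some (.num n)) {j : Fin N} {ts : ℕ → Term S}
    {xs : Fin (Y.r j) → Elem α} (h : ∀ k : Fin (Y.r j), (ts k).eval Z = some (xs k)) :
    (Y.call j ts).updates Z = some (Y.callSet n j xs) :=
  parAll_updates (fun k => Rule.par_updates (setVar_updates (h k))
      (Rule.assign_updates (fun _ => nextCnt_eval hZ hn) (h k)))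
    (Rule.par_updates (setVar_updates (nextCnt_eval hZ hn)) (setVar_updates (numeral_eval hZ _)))

/-! ### Representation of a simulated state, and correctness of the translation. -/

variable (Y) in
/-- The value of the `j`-th objective function at `xs` has been recorded. -/
def Known (Z : Struct S α) (j : Fin N) (xs : Fin (Y.r j) → Elem α) : Prop :=
  Z.fn (Y.sym (.known j)) (Y.r j) xs = some .tt

variable (Y) in
/-- If `q` is a query of the `i`-th algorithm, then the answer has been recorded. -/
def Resolved (Z : Struct S α) (i : Fin N) (q : Loc S α) : Prop :=
  (Y.A i).IsExtrinsic q.sym →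
    Z.fn (Y.sym (.known (Y.callee i q.sym))) q.arity q.args = some .tt

variable (Y) in
/-- Run `n` is at the state `X` of the `i`-th algorithm. -/
def Frame (Z : Struct S α) (n : ℕ) (i : Fin N) (X : Struct S α) : Prop :=
  ∀ f m, (Y.A i).blank.voc.mark f = some m → m.status = .dynamic → ∀ xs : Fin m.arity → Elem α,
    (∀ k, xs k ∈ (Y.A i).blank.base) →
    Z.fn (Y.sym (.frame i f)) (m.arity + 1) (Fin.cons (.num n) xs) = X.fn f m.arity xs

variable (Y) in
/-- The state `Z` of the simulating algorithm represents the state `X` of the `i`-th algorithm in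
run `n`, and records only correct answers to queries. -/
structure Represents (Z : Struct S α) (n : ℕ) (i : Fin N) (X : Struct S α) : Prop where
  state : Y.sim.IsState Z
  cnt : Z.fn (Y.sym .cnt) 0 ![] = some (.num n)
  state' : (Y.A i).IsState X
  frame : Y.Frame Z n i X
  memo : ∀ e, (Y.A i).IsExtrinsic e → ∀ xs, (∀ k, xs k ∈ (Y.A i).blank.base) →
    Y.Known Z (Y.callee i e) xs →
    Z.fn (Y.sym (.val (Y.callee i e))) (Y.r (Y.callee i e)) xs =
      X.fn e (Y.r (Y.callee i e)) xs

section Represents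

variable {Z : Struct S α} {n : ℕ} {i : Fin N} {X : Struct S α}

theorem cons_eval (h : Y.Represents Z n i X) {k : ℕ} {ts : Fin k → Term S}
    {us : Fin k → Term S} (hts : ∀ l, (ts l).eval Z = (us l).eval X) :
    (collect fun l => ((Fin.cons (Y.var .cnt) ts : Fin (k + 1) → Term S) l).eval Z) =
      (collect fun l => (us l).eval X).map fun xs => Fin.cons (.num n) xs := by
  rw [← collect_cons]
  congr 1
  funext l
  refine Fin.cases ?_ (fun l => ?_) l
  · exact (var_eval Z _).trans h.cnt
  · exact hts l

/-- An oracle is read from the table, where the answer is recorded and right; a dynamic function is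
read from the copy belonging to the run; an intrinsic function means the same in the union. All
three agreements hold only on elements of the `i`-th algorithm, which suffices since values of its
terms are such elements. -/
theorem tr_eval (h : Y.Represents Z n i X) : ∀ {t : Term S}, t.WF (Y.A i).blank.voc →
    (∀ q, t.Evaluates X q → Y.Resolved Z i q) → (Y.tr i t).eval Z = t.eval X := by
  intro t
  induction t with
  | app f k ts ih =>
    rintro ⟨⟨m, hm, rfl⟩, hts⟩ hq
    have hev : ∀ l, (Y.tr i (ts l)).eval Z = (ts l).eval X := fun l =>
      ih l (hts l) fun q hl => hq q (Or.inl ⟨l, hl⟩)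
    have hmem : ∀ xs, (collect fun l => (ts l).eval X) = some xs →
        ∀ l, xs l ∈ (Y.A i).blank.base := fun xs hxs l => h.state'.base ▸ Term.collect_mem hxs l
    simp only [tr]
    split_ifs with he hd
    · simp only [Term.eval, hev]
      rcases hc : (collect fun l => (ts l).eval X) with _ | xs
      · rfl
      · have hr := hq _ (Or.inr ⟨xs, hc, rfl⟩) he
        have hx := hmem xs hc
        have ha := Y.callee_arity he hm
        have hmemo := h.memo f he
        -- The arity of `f` must be replaced by that of the callee, also in the type of `xs`.
        -- Dropping what depends on `m` makes this substitution possible.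
        clear hq ih hev hmem hc hts hm
        obtain ⟨a, s, κ⟩ := m
        obtain rfl : a = _ := ha
        exact hmemo xs hx hr
    · obtain ⟨m', hm', hs⟩ := hd
      obtain rfl := Option.some.inj (hm.symm.trans hm')
      rw [Term.eval, cons_eval h hev, Term.eval]
      rcases hc : (collect fun l => (ts l).eval X) with _ | xs
      · rfl
      · exact h.frame f m hm hs xs (hmem xs hc)
    · simp only [Term.eval, hev]
      rcases hc : (collect fun l => (ts l).eval X) with _ | xs
      · rfl
      · obtain ⟨hi, hD⟩ := Y.data_of_static hm he hd
        have hs := Y.data_intrinsic hD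
        change Z.fn f m.arity xs = X.fn f m.arity xs
        rw [h.state'.static f m hm (by simp [hs]),
          h.state.static f m (Y.mark_data hD) (by simp [hs])]
        exact (Y.blank_data hD (hmem xs hc)).trans (if_pos hi)
  | tt => exact fun _ _ => rfl
  | ff => exact fun _ _ => rfl
  | nil => exact fun _ _ => rfl
  | not t ih =>
    intro ht hq
    simp only [tr, Term.eval, ih ht hq]
  | eq s t ihs iht =>
    intro ht hq
    simp only [tr, Term.eval, ihs ht.1 fun q hs => hq q (Or.inl hs),
      iht ht.2 fun q hs => hq q (Or.inr hs)]
  | and s t ihs iht =>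
    intro ht hq
    simp only [tr, Term.eval, ihs ht.1 fun q hs => hq q (Or.inl hs),
      iht ht.2 fun q hs => hq q (Or.inr hs)]
  | or s t ihs iht =>
    intro ht hq
    simp only [tr, Term.eval, ihs ht.1 fun q hs => hq q (Or.inl hs),
      iht ht.2 fun q hs => hq q (Or.inr hs)]
  | ite c s t ihc ihs iht =>
    intro ht hq
    simp only [tr, Term.eval, ihc ht.1 fun q hs => hq q (Or.inl hs)]
    rcases hc : c.eval X with _ | a
    · rfl
    · cases a
      case tt => exact ihs ht.2.1 fun q hs => hq q (Or.inr (Or.inl ⟨hc, hs⟩))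
      case ff => exact iht ht.2.2 fun q hs => hq q (Or.inr (Or.inr ⟨hc, hs⟩))
      all_goals rfl

variable (Y) in
/-- An update in run `n` of the `i`-th algorithm. -/
def shift (n : ℕ) (i : Fin N) (p : Loc S α × Elem α) : Loc S α × Elem α :=
  (⟨Y.sym (.frame i p.1.sym), p.1.arity + 1, Fin.cons (.num n) p.1.args⟩, p.2)

/-- The run number is the first argument of a shifted location, so different runs never touch the
same location, and within a run no locations get identified. -/
theorem shift_inj {n n' : ℕ} {i i' : Fin N} {p p' : Loc S α × Elem α}
    (h : (Y.shift n i p).1 = (Y.shift n' i' p').1) : n = n' ∧ p.1 = p'.1 := by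
  obtain ⟨⟨f, k, xs⟩, y⟩ := p
  obtain ⟨⟨f', k', xs'⟩, y'⟩ := p'
  simp only [shift, Loc.mk.injEq, Nat.add_right_cancel_iff] at h
  obtain ⟨h1, rfl, h2⟩ := h
  have h2 := eq_of_heq h2
  rw [Fin.cons_inj] at h2
  obtain ⟨h3, rfl⟩ := h2
  have h1 := Y.sym_injective h1
  simp only [Aux.frame.injEq] at h1
  exact ⟨Elem.num.inj h3, by simp [h1.2]⟩

theorem shift_content (h : Y.Represents Z n i X) {p : Loc S α × Elem α}
    (hp : (∃ m, X.voc.mark p.1.sym = some m ∧ m.status = .dynamic ∧ m.arity = p.1.arity) ∧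
        (∀ k, p.1.args k ∈ X.base) ∧ p.2 ∈ X.base) :
    Z.content (Y.shift n i p).1 = X.content p.1 := by
  obtain ⟨⟨f, k, xs⟩, y⟩ := p
  obtain ⟨⟨m, hm, hs, rfl⟩, hx, -⟩ := hp
  rw [h.state'.voc] at hm
  rw [h.state'.base] at hx
  exact h.frame f m hm hs xs hx

theorem trRule_updates (h : Y.Represents Z n i X) : ∀ {R : Rule S},
    R.WF (Y.A i).blank.voc → (∀ q, R.Evaluates X q → Y.Resolved Z i q) →
    (Y.trRule i R).updates Z = (R.updates X).map fun D => Y.shift n i '' D := by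
  intro R
  induction R with
  | assign f k ts t =>
    rintro ⟨-, hts, ht⟩ hq
    rw [trRule, Rule.updates, cons_eval h fun l =>
      tr_eval h (hts l) fun q hl => hq q (Or.inl ⟨l, hl⟩),
      tr_eval h ht fun q hl => hq q (Or.inr hl), Rule.updates]
    rcases (collect fun l => (ts l).eval X) with _ | xs
    · rfl
    · rcases t.eval X with _ | y
      · rfl
      · simp [shift]
  | cond b P Q ihP ihQ =>
    rintro ⟨hb, hb', hP, hQ⟩ hq
    have he := tr_eval h hb fun q hl => hq q (Or.inl hl)
    rw [trRule]
    rcases hc : b.eval X with _ | a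
    · rw [hc] at he
      simp [Rule.updates, Term.eval, he, hc]
    · rw [hc] at he
      -- The translated conditional treats every value except true like false. Booleanness of `b`
      -- excludes other values, at which the original rule would fail.
      rw [← h.state'.voc] at hb'
      rcases hb'.eval hc with rfl | rfl
      · rw [(Rule.cond_eq_updates he rfl).1 rfl,
          ihP hP fun q hl => hq q (Or.inr (Or.inl ⟨hc, hl⟩))]
        simp [Rule.updates, hc]
      · rw [(Rule.cond_eq_updates he rfl).2 (by simp),
          ihQ hQ fun q hl => hq q (Or.inr (Or.inr ⟨hc, hl⟩))]
        simp [Rule.updates, hc]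
  | par P Q ihP ihQ =>
    rintro ⟨hP, hQ⟩ hq
    rw [trRule, Rule.updates, ihP hP fun q hl => hq q (Or.inl hl),
      ihQ hQ fun q hl => hq q (Or.inr hl), Rule.updates]
    rcases P.updates X with _ | D
    · rfl
    · rcases Q.updates X with _ | E
      · rfl
      · simp [Set.image_union]

open Classical in
theorem stable_eval (h : Y.Represents Z n i X) : ∀ {R : Rule S},
    R.WF (Y.A i).blank.voc → (∀ q, R.Evaluates X q → Y.Resolved Z i q) →
    (Y.stable i R).eval Z = (R.updates X).map fun D =>
      if ∀ p ∈ D, X.content p.1 = some p.2 then .tt else .ff := by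
  intro R
  induction R with
  | assign f k ts t =>
    rintro ⟨⟨m, hm, hs, rfl⟩, hts, ht⟩ hq
    rw [stable, Term.eval, Term.eval, cons_eval h fun l =>
      tr_eval h (hts l) fun q hl => hq q (Or.inl ⟨l, hl⟩),
      tr_eval h ht fun q hl => hq q (Or.inr hl), Rule.updates]
    rcases hc : (collect fun l => (ts l).eval X) with _ | xs
    · rfl
    · have hx : ∀ k, xs k ∈ (Y.A i).blank.base := fun l => h.state'.base ▸ Term.collect_mem hc l
      have hf := h.frame f m hm hs xs hx
      -- Dynamic functions are total, so reading the old content cannot fail: the test is undefined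
      -- only where the assignment is.
      obtain ⟨a, ha⟩ := Option.ne_none_iff_exists'.1 (h.state'.total f m hm hs xs hx)
      rw [ha] at hf
      rcases t.eval X with _ | y
      · simp [hf]
      · simp [hf, Struct.content, ha]
  | cond b P Q ihP ihQ =>
    rintro ⟨hb, hb', hP, hQ⟩ hq
    have he := tr_eval h hb fun q hl => hq q (Or.inl hl)
    rw [stable, Term.eval, he, Rule.updates]
    rcases hc : b.eval X with _ | a
    · rfl
    · rw [← h.state'.voc] at hb'
      rcases hb'.eval hc with rfl | rfl
      · exact ihP hP fun q hl => hq q (Or.inr (Or.inl ⟨hc, hl⟩))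
      · exact ihQ hQ fun q hl => hq q (Or.inr (Or.inr ⟨hc, hl⟩))
  | par P Q ihP ihQ =>
    rintro ⟨hP, hQ⟩ hq
    rw [stable, Term.eval, ihP hP fun q hl => hq q (Or.inl hl),
      ihQ hQ fun q hl => hq q (Or.inr hl), Rule.updates]
    rcases P.updates X with _ | D
    · rfl
    · rcases Q.updates X with _ | E
      · rfl
      · simp only [Option.map_some, Option.bind_some, Set.mem_union, or_imp, forall_and]
        generalize (∀ p ∈ D, X.content p.1 = some p.2) = p
        generalize (∀ p ∈ E, X.content p.1 = some p.2) = q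
        by_cases hp : p <;> by_cases hq : q <;> simp [hp, hq, Elem.and]

/-! ### Guards: detecting queries without a recorded answer. -/

variable (Y) in
/-- What a guard does: `ev` says which functions the guarded expression evaluates, and `undef` says
that its evaluation fails. The updates are those of the guarded rule, unless the evaluation fails
or there is an unresolved query. -/
def GuardSpec (Z : Struct S α) (n : ℕ) (i : Fin N) (ev : Loc S α → Prop) (undef : Prop)
    (U V : Option (Set (Loc S α × Elem α))) : Prop :=
  (∀ q, ev q → Y.Resolved Z i q) ∧ U = V ∨ U = none ∧ undef ∨
    ∃ e xs, (Y.A i).IsExtrinsic e ∧ ev ⟨e, Y.r (Y.callee i e), xs⟩ ∧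
      ¬ Y.Known Z (Y.callee i e) xs ∧ U = some (Y.callSet n (Y.callee i e) xs)

/-- Guards compose sequentially. The second one matters only if the first has found everything
resolved, so its specification may assume this; that is where `tr_eval` becomes available for the
later tests. -/
theorem GuardSpec.trans {ev ev₁ ev₂ : Loc S α → Prop} {u u₁ u₂ : Prop}
    {U V W : Option (Set (Loc S α × Elem α))} (h₁ : Y.GuardSpec Z n i ev₁ u₁ U V)
    (h₂ : (∀ q, ev₁ q → Y.Resolved Z i q) → Y.GuardSpec Z n i ev₂ u₂ V W)
    (hev : ∀ q, ev q ↔ ev₁ q ∨ ev₂ q) (hu : u₁ ∨ u₂ → u) : Y.GuardSpec Z n i ev u U W := by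
  rcases h₁ with ⟨hr, rfl⟩ | ⟨rfl, h⟩ | ⟨e, xs, h, h', h''⟩
  · rcases h₂ hr with ⟨hr', rfl⟩ | ⟨rfl, h⟩ | ⟨e, xs, h, h', h''⟩
    · exact Or.inl ⟨fun q hq => ((hev q).1 hq).elim (hr q) (hr' q), rfl⟩
    · exact Or.inr (Or.inl ⟨rfl, hu (Or.inr h)⟩)
    · exact Or.inr (Or.inr ⟨e, xs, h, (hev _).2 (Or.inr h'), h''⟩)
  · exact Or.inr (Or.inl ⟨rfl, hu (Or.inl h)⟩)
  · exact Or.inr (Or.inr ⟨e, xs, h, (hev _).2 (Or.inl h'), h''⟩)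

theorem GuardSpec.mono {ev ev' : Loc S α → Prop} {u u' : Prop}
    {U V : Option (Set (Loc S α × Elem α))} (h : Y.GuardSpec Z n i ev u U V)
    (hev : ∀ q, ev' q ↔ ev q) (hu : u → u') : Y.GuardSpec Z n i ev' u' U V :=
  h.trans (ev₂ := fun _ => False) (u₂ := False) (fun _ => Or.inl ⟨fun _ hq => hq.elim, rfl⟩)
    (by simpa using hev) (by simpa using hu)

theorem GuardSpec.refl {ev : Loc S α → Prop} {u : Prop} {U : Option (Set (Loc S α × Elem α))}
    (hev : ∀ q, ¬ ev q) : Y.GuardSpec Z n i ev u U U :=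
  Or.inl ⟨fun q hq => (hev q hq).elim, rfl⟩

theorem guardSpec_foldr {k : ℕ} {ts : Fin k → Term S} (K : Rule S)
    (h : ∀ l K, Y.GuardSpec Z n i ((ts l).Evaluates X) ((ts l).eval X = none)
      ((Y.guard i (ts l) K).updates Z) (K.updates Z)) :
    Y.GuardSpec Z n i (fun q => ∃ l, (ts l).Evaluates X q)
      ((collect fun l => (ts l).eval X) = none)
      (((List.finRange k).foldr (fun l R => Y.guard i (ts l) R) K).updates Z) (K.updates Z) := by
  have key : ∀ ls : List (Fin k), Y.GuardSpec Z n i (fun q => ∃ l ∈ ls, (ts l).Evaluates X q)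
      ((collect fun l => (ts l).eval X) = none)
      ((ls.foldr (fun l R => Y.guard i (ts l) R) K).updates Z) (K.updates Z) := by
    intro ls
    induction ls with
    | nil => exact GuardSpec.refl (by simp)
    | cons a ls ih =>
      refine (h a _).trans (fun _ => ih) (by simp) ?_
      rintro (h | h)
      exacts [collect_eq_none.2 ⟨a, h⟩, h]
  exact (key _).mono (by simp) id

/-- The arguments of a query are guarded before the query itself, so their translations have the
true values when the table is consulted. Hence a run is only ever started for a query that the
evaluation really poses. -/
theorem guardSpec_guard (h : Y.Represents Z n i X) {t : Term S} (ht : t.WF (Y.A i).blank.voc)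
    (K : Rule S) : Y.GuardSpec Z n i (t.Evaluates X) (t.eval X = none)
      ((Y.guard i t K).updates Z) (K.updates Z) := by
  induction t generalizing K with
  | app f k ts ih =>
    obtain ⟨⟨m, hm, rfl⟩, hts⟩ := ht
    rw [guard]
    refine (guardSpec_foldr _ fun l K => ih l (hts l) K).trans
      (u₂ := (collect fun l => (ts l).eval X) = none)
      (ev₂ := fun q => ∃ xs, (collect fun k => (ts k).eval X) = some xs ∧ q = ⟨f, m.arity, xs⟩)
      (fun hr => ?_) (fun q => Iff.rfl) ?_
    · have hev : ∀ l, (Y.tr i (ts l)).eval Z = (ts l).eval X := fun l =>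
        tr_eval h (hts l) fun q hl => hr q ⟨l, hl⟩
      split_ifs with he
      · rcases hc : (collect fun l => (ts l).eval X) with _ | xs
        · refine Or.inr (Or.inl ⟨Rule.cond_eq_updates_none ?_, rfl⟩)
          simp only [Term.eval, hev, hc]
          rfl
        · have hx : ∀ l, xs l ∈ Y.base := fun l =>
            Y.base_subset i (h.state'.base ▸ Term.collect_mem hc l)
          have hxs : ∀ l, (Y.tr i (ts l)).eval Z = some (xs l) := fun l =>
            (hev l).trans (collect_eq_some.1 hc l)
          have ha := Y.callee_arity he hm
          clear hr ih hev hc hts hm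
          obtain ⟨a, s, κ⟩ := m
          obtain rfl : a = _ := ha
          -- The table is total, so consulting it at an unrecorded argument does not fail.
          obtain ⟨y, hy⟩ := aux_total h.state (a := .known (Y.callee i f)) rfl hx
          have hy' := (Term.eval_app_of (f := Y.sym (.known (Y.callee i f))) hxs).trans hy
          by_cases hyt : y = .tt
          · subst hyt
            refine Or.inl ⟨?_, (Rule.cond_eq_updates hy' rfl).1 rfl⟩
            rintro _ ⟨_, hx', rfl⟩ -
            obtain rfl := Option.some.inj hx'
            exact hy
          · refine Or.inr (Or.inr ⟨f, xs, he, ⟨xs, rfl, rfl⟩, fun hk => hyt ?_, ?_⟩)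
            · exact Option.some.inj (hy.symm.trans hk)
            · rw [(Rule.cond_eq_updates hy' rfl).2 hyt]
              exact call_updates h.state h.cnt fun l => by simpa using hxs l
      · refine Or.inl ⟨?_, rfl⟩
        rintro _ ⟨xs, -, rfl⟩ he'
        exact (he he').elim
    · rintro (hc | hc) <;>
      · rw [Term.eval, hc]
        rfl
  | tt => exact GuardSpec.refl fun _ hq => hq
  | ff => exact GuardSpec.refl fun _ hq => hq
  | nil => exact GuardSpec.refl fun _ hq => hq
  | not t ih => exact (ih ht K).mono (fun q => Iff.rfl) fun h0 => by simp [Term.eval, h0]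
  | eq s t ihs iht =>
    refine (ihs ht.1 _).trans (fun _ => iht ht.2 K) (fun q => Iff.rfl) ?_
    rintro (h0 | h0) <;> simp [Term.eval, h0]
  | and s t ihs iht =>
    refine (ihs ht.1 _).trans (fun _ => iht ht.2 K) (fun q => Iff.rfl) ?_
    rintro (h0 | h0) <;> simp [Term.eval, h0]
  | or s t ihs iht =>
    refine (ihs ht.1 _).trans (fun _ => iht ht.2 K) (fun q => Iff.rfl) ?_
    rintro (h0 | h0) <;> simp [Term.eval, h0]
  | ite c s t ihc ihs iht =>
    refine (ihc ht.1 _).trans (u₂ := (Term.ite c s t).eval X = none)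
      (ev₂ := fun q => (c.eval X = some .tt ∧ s.Evaluates X q) ∨
        (c.eval X = some .ff ∧ t.Evaluates X q)) (fun hr => ?_) (fun q => Iff.rfl) ?_
    · have he := tr_eval h ht.1 hr
      rcases hc : c.eval X with _ | a
      · rw [hc] at he
        exact Or.inr (Or.inl ⟨Rule.cond_eq_updates_none he, by simp [Term.eval, hc]⟩)
      · rw [hc] at he
        by_cases ha : a = .tt
        · subst ha
          rw [(Rule.cond_eq_updates he rfl).1 rfl]
          exact (ihs ht.2.1 K).mono (by simp) fun h0 => by simp [Term.eval, hc, h0]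
        · rw [(Rule.cond_eq_updates he rfl).2 ha]
          by_cases ha' : a = .ff
          · subst ha'
            rw [(Rule.cond_eq_updates he rfl).1 rfl]
            exact (iht ht.2.2 K).mono (by simp) fun h0 => by simp [Term.eval, hc, h0]
          · rw [(Rule.cond_eq_updates he rfl).2 ha']
            -- For a condition that is neither true nor false, no branch is evaluated and nothing
            -- remains to be guarded.
            exact GuardSpec.refl (by simp [ha, ha'])
    · rintro (h0 | h0)
      · simp [Term.eval, h0]
      · exact h0

theorem guardSpec_guardRule (h : Y.Represents Z n i X) {R : Rule S}
    (hR : R.WF (Y.A i).blank.voc) (K : Rule S) :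
    Y.GuardSpec Z n i (R.Evaluates X) (R.updates X = none)
      ((Y.guardRule i R K).updates Z) (K.updates Z) := by
  induction R generalizing K with
  | assign f k ts t =>
    refine (guardSpec_foldr _ fun l K => guardSpec_guard h (hR.2.1 l) K).trans
      (fun _ => guardSpec_guard h hR.2.2 K) (fun q => Iff.rfl) ?_
    rintro (h0 | h0) <;> simp [Rule.updates, h0]
  | cond b P Q ihP ihQ =>
    obtain ⟨hb, hb', hP, hQ⟩ := hR
    refine (guardSpec_guard h hb _).trans (u₂ := (Rule.cond b P Q).updates X = none)
      (ev₂ := fun q => (b.eval X = some .tt ∧ P.Evaluates X q) ∨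
        (b.eval X = some .ff ∧ Q.Evaluates X q)) (fun hr => ?_) (fun q => Iff.rfl) ?_
    · have he := tr_eval h hb hr
      rcases hc : b.eval X with _ | a
      · rw [hc] at he
        exact Or.inr (Or.inl ⟨Rule.cond_eq_updates_none he, by simp [Rule.updates, hc]⟩)
      · rw [hc] at he
        rw [← h.state'.voc] at hb'
        rcases hb'.eval hc with rfl | rfl
        · rw [(Rule.cond_eq_updates he rfl).1 rfl]
          exact (ihP hP K).mono (by simp) fun h0 => by simp [Rule.updates, hc, h0]
        · rw [(Rule.cond_eq_updates he rfl).2 (by simp)]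
          exact (ihQ hQ K).mono (by simp) fun h0 => by simp [Rule.updates, hc, h0]
    · rintro (h0 | h0)
      · simp [Rule.updates, h0]
      · exact h0
  | par P Q ihP ihQ =>
    refine (ihP hR.1 _).trans (fun _ => ihQ hR.2 K) (fun q => Iff.rfl) ?_
    rintro (h0 | h0) <;> simp [Rule.updates, h0]

end Represents

end System

namespace System

variable {N : ℕ} [NeZero N] (Y : System S α N)

/-! ### Invariants of the simulating algorithm -/

/-- What holds throughout the computation on the input `x`; `n` is the number of the current or
the last run. -/
structure Inv (x : Fin (Y.r 0) → Elem α) (Z : Struct S α) (n : ℕ) : Prop where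
  state : Y.sim.IsState Z
  cnt : Z.fn (Y.sym .cnt) 0 ![] = some (.num n)
  inp : ∀ k : Fin (Y.r 0), Z.fn (Y.sym (.inp k)) 0 ![] = some (x k)
  memo : ∀ j xs, Y.Known Z j xs →
    ∃ y, Z.fn (Y.sym (.val j)) (Y.r j) xs = some y ∧ (Y.A j).Computes xs y
  fresh : ∀ i f m, (Y.A i).blank.voc.mark f = some m → m.status = .dynamic → ∀ n' > n,
    ∀ xs : Fin m.arity → Elem α, (∀ k, xs k ∈ (Y.A i).blank.base) →
      Z.fn (Y.sym (.frame i f)) (m.arity + 1) (Fin.cons (.num n') xs) = some m.kind.dflt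

/-- The simulating algorithm is between runs. -/
def Idle (Z : Struct S α) : Prop := Z.fn (Y.sym .phase) 0 ![] = some (.num 0)

/-- The simulating algorithm is in run `n`, a run of the `i`-th algorithm on the input `x`, which
has reached the state `X`. -/
structure Running (Z : Struct S α) (n : ℕ) (i : Fin N) (x : Fin (Y.r i) → Elem α)
    (X : Struct S α) : Prop where
  phase : Z.fn (Y.sym .phase) 0 ![] = some (.num (i + 1))
  dom : x ∈ (Y.A i).dom
  reaches : (Y.A i).Reaches x X
  frame : Y.Frame Z n i X
  arg : ∀ k : Fin (Y.r i), Z.fn (Y.sym (.arg i k)) 0 ![] = some (x k)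
  unknown : ¬ Y.Known Z i x

/-- The updates at the end of a run. -/
def finishSet (i : Fin N) (x : Fin (Y.r i) → Elem α) (y : Elem α) : Set (Loc S α × Elem α) :=
  {(⟨Y.sym (.known i), Y.r i, x⟩, .tt)} ∪
    ({(⟨Y.sym (.val i), Y.r i, x⟩, y)} ∪ {(⟨Y.sym .phase, 0, ![]⟩, .num 0)})

variable {Y} {x : Fin (Y.r 0) → Elem α} {Z Z' : Struct S α} {n : ℕ}

/-- Correct table entries are correct oracle answers, because the oracle agrees with the objective
function of its callee. -/
theorem Inv.represents (h : Y.Inv x Z n) {i : Fin N} {x' : Fin (Y.r i) → Elem α}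
    {X : Struct S α} (hX : Y.Running Z n i x' X) : Y.Represents Z n i X where
  state := h.state
  cnt := h.cnt
  state' := hX.reaches.isState
  frame := hX.frame
  memo e he xs hxs hk := by
    obtain ⟨y, hy, hc⟩ := h.memo _ _ hk
    obtain ⟨m, hm, hs⟩ := he
    rw [hy, hX.reaches.isState.static e m hm (by simp [hs])]
    exact (((Y.objective i e ⟨m, hm, hs⟩).agree xs hc.1 hxs y).2 hc).symm

theorem loc_ne {a b : Aux N S} (h : a ≠ b) {k l : ℕ} {xs : Fin k → Elem α}
    {ys : Fin l → Elem α} : (⟨Y.sym a, k, xs⟩ : Loc S α) ≠ ⟨Y.sym b, l, ys⟩ :=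
  fun h' => h (Y.sym_injective (congrArg Loc.sym h'))

/-- Comparing heads avoids comparing argument tuples of possibly different lengths. -/
theorem frame_ne {a b : Aux N S} {p q k : ℕ} (h : p ≠ q) {xs : Fin k → Elem α} :
    (⟨Y.sym a, 1, fun _ => .num p⟩ : Loc S α) ≠ ⟨Y.sym b, k + 1, Fin.cons (.num q) xs⟩ := by
  intro h'
  have := congrArg Loc.head h'
  simp [Loc.head] at this
  exact h this

/-! ### The effect of the steps -/

theorem call_other {j : Fin N} {xs : Fin (Y.r j) → Elem α}
    (hu : Z.IsUpdate (Y.callSet n j xs) Z') {a : Aux N S} (h₁ : ∀ j k, a ≠ .arg j k)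
    (h₂ : ∀ i f, a ≠ .frame i f) (h₃ : a ≠ .cnt) (h₄ : a ≠ .phase) {l : ℕ}
    (ys : Fin l → Elem α) : Z'.fn (Y.sym a) l ys = Z.fn (Y.sym a) l ys := by
  refine hu.fn_other fun p hp => ?_
  rcases mem_callSet.1 hp with ⟨k, rfl⟩ | ⟨k, rfl⟩ | rfl | rfl
  · exact loc_ne (h₁ _ _).symm
  · exact loc_ne (h₂ _ _).symm
  · exact loc_ne h₃.symm
  · exact loc_ne h₄.symm

/-- The copy with number `n + 1` still has its default values, so setting the input variables there
makes it an initial state of the `j`-th algorithm. Nothing about the abandoned run has to be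
preserved. -/
theorem Inv.call (h : Y.Inv x Z n) (hZ' : Y.sim.IsState Z') {j : Fin N}
    {xs : Fin (Y.r j) → Elem α} (hxs : xs ∈ (Y.A j).dom) (hk : ¬ Y.Known Z j xs)
    (hu : Z.IsUpdate (Y.callSet n j xs) Z') :
    Y.Inv x Z' (n + 1) ∧ (∃ X, Y.Running Z' (n + 1) j xs X) ∧
      ∀ i ys, Y.Known Z' i ys ↔ Y.Known Z i ys := by
  have hkn : ∀ i ys, Y.Known Z' i ys ↔ Y.Known Z i ys := by
    intro i ys
    rw [Known, call_other hu (by simp) (by simp) (by simp) (by simp)]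
    rfl
  refine ⟨⟨hZ', hu.fn (mem_callSet.2 (Or.inr (Or.inr (Or.inl rfl)))), fun k => ?_,
    fun i ys hi => ?_, fun i f m hm hs n' hn' ys hys => ?_⟩, ?_, hkn⟩
  · rw [call_other hu (by simp) (by simp) (by simp) (by simp)]
    exact h.inp k
  · rw [call_other hu (by simp) (by simp) (by simp) (by simp)]
    exact h.memo i ys ((hkn i ys).1 hi)
  · rw [hu.fn_other]
    · exact h.fresh i f m hm hs n' (by omega) ys hys
    · intro p hp
      rcases mem_callSet.1 hp with ⟨k, rfl⟩ | ⟨k, rfl⟩ | rfl | rfl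
      · exact loc_ne (by simp)
      -- The inputs are written into copy `n + 1`, and freshness is now claimed only beyond that
      -- number.
      · exact frame_ne (by omega)
      · exact loc_ne (by simp)
      · exact loc_ne (by simp)
  · obtain ⟨X, hX⟩ := Algorithm.exists_isInitial hxs
    refine ⟨X, hu.fn (mem_callSet.2 (Or.inr (Or.inr (Or.inr rfl)))), hxs, ⟨X, hX, .refl⟩,
      fun f m hm hs ys hys => ?_, fun k => hu.fn (mem_callSet.2 (Or.inl ⟨k, rfl⟩)),
      fun hk' => hk ((hkn j xs).1 hk')⟩
    by_cases hf : ∃ k, f = (Y.A j).input k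
    · obtain ⟨k, rfl⟩ := hf
      obtain ⟨κ, hm', -⟩ := Y.auxMark_input k
      obtain rfl := Option.some.inj (hm.symm.trans hm')
      have h1 := hX.input k
      rw [Subsingleton.elim ![] ys] at h1
      refine Eq.trans ?_ h1.symm
      refine Eq.trans ?_ (hu.fn (mem_callSet.2 (Or.inr (Or.inl ⟨k, rfl⟩))))
      refine congrArg (Z'.fn _ 1) ?_
      funext l
      rw [Subsingleton.elim (α := Fin 1) l 0]
      rfl
    · push Not at hf
      rw [hX.other f hf, (Y.A j).uninformative f m hm hs ys hys, hu.fn_other]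
      · exact h.fresh j f m hm hs _ (by omega) ys hys
      · intro p hp
        rcases mem_callSet.1 hp with ⟨k, rfl⟩ | ⟨k, rfl⟩ | rfl | rfl
        · exact loc_ne (by simp)
        · exact loc_ne (by simpa using (hf k).symm)
        · exact loc_ne (by simp)
        · exact loc_ne (by simp)

theorem finish_other {i : Fin N} {x' : Fin (Y.r i) → Elem α} {y : Elem α}
    (hu : Z.IsUpdate (Y.finishSet i x' y) Z') {a : Aux N S} {l : ℕ} {ys : Fin l → Elem α}
    (h₁ : (⟨Y.sym (.known i), Y.r i, x'⟩ : Loc S α) ≠ ⟨Y.sym a, l, ys⟩)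
    (h₂ : (⟨Y.sym (.val i), Y.r i, x'⟩ : Loc S α) ≠ ⟨Y.sym a, l, ys⟩) (h₃ : a ≠ .phase) :
    Z'.fn (Y.sym a) l ys = Z.fn (Y.sym a) l ys := by
  refine hu.fn_other fun p hp => ?_
  rcases hp with rfl | rfl | rfl
  exacts [h₁, h₂, loc_ne h₃.symm]

theorem Inv.finish (h : Y.Inv x Z n) (hZ' : Y.sim.IsState Z') {i : Fin N}
    {x' : Fin (Y.r i) → Elem α} {y : Elem α} (hy : (Y.A i).Computes x' y)
    (hu : Z.IsUpdate (Y.finishSet i x' y) Z') :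
    Y.Inv x Z' n ∧ Y.Idle Z' ∧ Y.Known Z' i x' ∧
      ∀ j ys, Y.Known Z j ys → Y.Known Z' j ys := by
  have hkn : Y.Known Z' i x' := hu.fn (Or.inl rfl)
  have hother : ∀ j ys, (⟨j, ys⟩ : Σ j, Fin (Y.r j) → Elem α) ≠ ⟨i, x'⟩ →
      Z'.fn (Y.sym (.known j)) (Y.r j) ys = Z.fn (Y.sym (.known j)) (Y.r j) ys ∧
      Z'.fn (Y.sym (.val j)) (Y.r j) ys = Z.fn (Y.sym (.val j)) (Y.r j) ys := by
    intro j ys hne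
    constructor <;> refine finish_other hu ?_ ?_ (by simp)
    · intro he
      have := Y.sym_injective (congrArg Loc.sym he)
      simp only [Aux.known.injEq] at this
      subst this
      simp at he
      exact hne (by rw [he])
    · exact loc_ne (by simp)
    · exact loc_ne (by simp)
    · intro he
      have := Y.sym_injective (congrArg Loc.sym he)
      simp only [Aux.val.injEq] at this
      subst this
      simp at he
      exact hne (by rw [he])
  refine ⟨⟨hZ', ?_, fun k => ?_, fun j ys hj => ?_, fun j f m hm hs n' hn' ys hys => ?_⟩,
    hu.fn (Or.inr (Or.inr rfl)), hkn, fun j ys hj => ?_⟩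
  · rw [finish_other hu (loc_ne (by simp)) (loc_ne (by simp)) (by simp)]
    exact h.cnt
  · rw [finish_other hu (loc_ne (by simp)) (loc_ne (by simp)) (by simp)]
    exact h.inp k
  · by_cases he : (⟨j, ys⟩ : Σ j, Fin (Y.r j) → Elem α) = ⟨i, x'⟩
    · obtain ⟨rfl, he⟩ := Sigma.mk.inj he
      obtain rfl := eq_of_heq he
      exact ⟨y, hu.fn (Or.inr (Or.inl rfl)), hy⟩
    · obtain ⟨h1, h2⟩ := hother j ys he
      rw [h2]
      rw [Known, h1] at hj
      exact h.memo j ys hj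
  · rw [finish_other hu (loc_ne (by simp)) (loc_ne (by simp)) (by simp)]
    exact h.fresh j f m hm hs n' hn' ys hys
  · by_cases he : (⟨j, ys⟩ : Σ j, Fin (Y.r j) → Elem α) = ⟨i, x'⟩
    · obtain ⟨rfl, he⟩ := Sigma.mk.inj he
      obtain rfl := eq_of_heq he
      exact hkn
    · rw [Known, (hother j ys he).1]
      exact hj

/-- A simulated step writes only into copy `n`, so the table, the stored arguments and all later
copies stay as they are. -/
theorem Inv.simulate (h : Y.Inv x Z n) (hZ' : Y.sim.IsState Z') {i : Fin N}
    {x' : Fin (Y.r i) → Elem α} {X X' : Struct S α} (hX : Y.Running Z n i x' X)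
    {D : Set (Loc S α × Elem α)} (hD : (Y.A i).program.updates X = some D)
    (hX' : X.IsUpdate D X') (hu : Z.IsUpdate (Y.shift n i '' D) Z') :
    Y.Inv x Z' n ∧ Y.Running Z' n i x' X' ∧ ∀ j ys, Y.Known Z' j ys ↔ Y.Known Z j ys := by
  have hother : ∀ a : Aux N S, (∀ i f, a ≠ .frame i f) → Z'.fn (Y.sym a) = Z.fn (Y.sym a) := by
    intro a ha
    funext l ys
    refine hu.fn_other ?_
    rintro _ ⟨p, -, rfl⟩
    exact loc_ne (ha _ _).symm
  have hkn : ∀ j ys, Y.Known Z' j ys ↔ Y.Known Z j ys := by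
    intro j ys
    rw [Known, hother _ (by simp)]
    rfl
  refine ⟨⟨hZ', ?_, fun k => ?_, fun j ys hj => ?_, fun j f m hm hs n' hn' ys hys => ?_⟩,
    ⟨?_, hX.dom, hX.reaches.step (Rule.step_iff.2 ⟨D, hD, hX'⟩), fun f m hm hs ys hys => ?_,
      fun k => ?_, fun hk => hX.unknown ((hkn _ _).1 hk)⟩, hkn⟩
  · rw [hother _ (by simp)]
    exact h.cnt
  · rw [hother _ (by simp)]
    exact h.inp k
  · rw [hother _ (by simp)]
    exact h.memo j ys ((hkn _ _).1 hj)
  · rw [hu.fn_other]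
    · exact h.fresh j f m hm hs n' hn' ys hys
    · rintro _ ⟨p, -, rfl⟩ he
      -- The value `.tt` is a dummy: only the locations are compared.
      have := (shift_inj (p' := (⟨f, m.arity, ys⟩, .tt)) he).1
      omega
  · rw [hother _ (by simp)]
    exact hX.phase
  · by_cases hl : ∃ y, ((⟨f, m.arity, ys⟩ : Loc S α), y) ∈ D
    · obtain ⟨y, hy⟩ := hl
      rw [hX'.fn hy]
      exact hu.fn ⟨_, hy, rfl⟩
    · push Not at hl
      have h1 := hX'.other _ hl
      simp only [Struct.content] at h1
      rw [h1, hu.fn_other]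
      · exact hX.frame f m hm hs ys hys
      · rintro _ ⟨⟨l, y⟩, hp, rfl⟩ he
        obtain rfl : l = _ := (shift_inj (p' := (⟨f, m.arity, ys⟩, .tt)) he).2
        exact hl y hp
  · rw [hother _ (by simp)]
    exact hX.arg k

theorem Inv.out (h : Y.Inv x Z n) (hZ' : Y.sim.IsState Z') (hi : Y.Idle Z) {y : Elem α}
    (hu : Z.IsUpdate {(⟨Y.sym .out, 0, ![]⟩, y)} Z') :
    Y.Inv x Z' n ∧ Y.Idle Z' ∧ Z'.fn (Y.sym .out) 0 ![] = some y ∧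
      ∀ a, a ≠ .out → Z'.fn (Y.sym a) = Z.fn (Y.sym a) := by
  have hother : ∀ a : Aux N S, a ≠ .out → Z'.fn (Y.sym a) = Z.fn (Y.sym a) := by
    intro a ha
    funext l ys
    refine hu.fn_other ?_
    rintro _ rfl
    exact loc_ne ha.symm
  refine ⟨⟨hZ', ?_, fun k => ?_, fun j ys hj => ?_, fun j f m hm hs n' hn' ys hys => ?_⟩, ?_,
    hu.fn rfl, hother⟩
  · rw [hother _ (by simp)]
    exact h.cnt
  · rw [hother _ (by simp)]
    exact h.inp k
  · rw [hother _ (by simp)]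
    rw [Known, hother _ (by simp)] at hj
    exact h.memo j ys hj
  · rw [hother _ (by simp)]
    exact h.fresh j f m hm hs n' hn' ys hys
  · rw [Idle, hother _ (by simp)]
    exact hi

/-! ### The updates of the simulating algorithm -/

theorem program_updates_idle (h : Y.sim.IsState Z) (hi : Y.Idle Z) :
    Y.program.updates Z = Y.idle.updates Z :=
  (Rule.cond_eq_updates ((var_eval Z _).trans hi) (numeral_eval h 0)).1 rfl

theorem program_updates_run (h : Y.sim.IsState Z) {i : Fin N}
    (hi : Z.fn (Y.sym .phase) 0 ![] = some (.num (i + 1))) :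
    Y.program.updates Z = (Y.run i).updates Z := by
  have hv := (var_eval Z _).trans hi
  rw [program, (Rule.cond_eq_updates hv (numeral_eval h 0)).2 (by simp)]
  have key : ∀ (R₀ : Rule S) (l : List (Fin N)), i ∈ l → ((l.foldr (fun (i : Fin N) R =>
      Rule.cond (.eq (Y.var .phase) (Y.numeral (i + 1))) (Y.run i) R) R₀)).updates Z =
      (Y.run i).updates Z := by
    intro R₀ l
    induction l with
    | nil => intro h; cases h
    | cons a l ih =>
      intro hil
      rw [List.foldr_cons]
      by_cases ha : i = a
      · subst ha
        exact (Rule.cond_eq_updates hv (numeral_eval h _)).1 rfl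
      · rw [(Rule.cond_eq_updates hv (numeral_eval h _)).2 (by simpa [Fin.val_inj] using ha)]
        exact ih ((List.mem_cons.1 hil).resolve_left ha)
  exact key _ _ (List.mem_finRange i)

theorem Inv.idle_updates (h : Y.Inv x Z n) (hx : x ∈ (Y.A 0).dom) (hi : Y.Idle Z) :
    (∃ y, Y.Known Z 0 x ∧ (Y.A 0).Computes x y ∧
      Y.program.updates Z = some {(⟨Y.sym .out, 0, ![]⟩, y)}) ∨
    ¬ Y.Known Z 0 x ∧ Y.program.updates Z = some (Y.callSet n 0 x) := by
  rw [program_updates_idle h.state hi, idle]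
  have hin : ∀ k : Fin (Y.r 0), (Y.var (.inp k)).eval Z = some (x k) := fun k =>
    (var_eval Z _).trans (h.inp k)
  obtain ⟨a, ha⟩ := aux_total h.state (a := .known 0) (xs := x) rfl fun k =>
    Y.base_subset 0 ((Y.A 0).dom_mem x hx k).1
  have ha' := (Term.eval_app_of (f := Y.sym (.known 0)) hin).trans ha
  by_cases hat : a = .tt
  · subst hat
    obtain ⟨y, hy, hc⟩ := h.memo 0 x ha
    refine Or.inl ⟨y, ha, hc, ?_⟩
    rw [(Rule.cond_eq_updates ha' rfl).1 rfl]
    exact setVar_updates ((Term.eval_app_of hin).trans hy)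
  · refine Or.inr ⟨fun hk => hat (Option.some.inj (ha.symm.trans hk)), ?_⟩
    rw [(Rule.cond_eq_updates ha' rfl).2 hat]
    exact call_updates h.state h.cnt hin

/-- Once the guard passes, the stability test and the translated rule see the true values. If it
does not pass, either the original rule fails as well or a genuine query is unanswered; being
genuine, it is admissible for its callee. -/
theorem Inv.run_updates (h : Y.Inv x Z n) {i : Fin N} {x' : Fin (Y.r i) → Elem α}
    {X : Struct S α} (hX : Y.Running Z n i x' X) :
    (∃ q : Σ j, Fin (Y.r j) → Elem α, Calls Y.A Y.callee ⟨i, x'⟩ q ∧ q.2 ∈ (Y.A q.1).dom ∧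
      ¬ Y.Known Z q.1 q.2 ∧ Y.program.updates Z = some (Y.callSet n q.1 q.2)) ∨
    (Y.program.updates Z = none ∧ (Y.A i).program.updates X = none) ∨
    (∃ y, (Y.A i).program.Step X X ∧ (Y.A i).Computes x' y ∧
      Y.program.updates Z = some (Y.finishSet i x' y)) ∨
    ∃ D, (Y.A i).program.updates X = some D ∧ ¬ (∀ p ∈ D, X.content p.1 = some p.2) ∧
      Y.program.updates Z = some (Y.shift n i '' D) := by
  classical
  have hr := h.represents hX
  have hwf := (Y.A i).program_wf
  rw [program_updates_run h.state hX.phase, run]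
  rcases guardSpec_guardRule hr hwf _ with ⟨hq, hU⟩ | hU | ⟨e, xs, he, hev, hk, hU⟩
  · rw [hU]
    have hst := stable_eval hr hwf hq
    rcases hD : (Y.A i).program.updates X with _ | D
    · rw [hD] at hst
      exact Or.inr (Or.inl ⟨Rule.cond_eq_updates_none hst, rfl⟩)
    · rw [hD, Option.map_some] at hst
      split_ifs at hst with htr
      · refine Or.inr (Or.inr (Or.inl ?_))
        obtain ⟨κ, hm, -⟩ := Y.auxMark_output i
        obtain ⟨y, hy⟩ := Option.ne_none_iff_exists'.1
          (hX.reaches.isState.total _ _ hm rfl ![] fun k => k.elim0)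
        have hs := Rule.step_self_iff.2 ⟨D, hD, htr⟩
        refine ⟨y, hs, ⟨hX.dom, X, hX.reaches, hs, hy⟩, ?_⟩
        rw [(Rule.cond_eq_updates hst rfl).1 rfl]
        have harg : ∀ k : Fin (Y.r i), (Y.var (.arg i k)).eval Z = some (x' k) := fun k =>
          (var_eval Z _).trans (hX.arg k)
        refine Rule.par_updates (Rule.assign_updates harg rfl)
          (Rule.par_updates (Rule.assign_updates harg ?_)
            (setVar_updates (numeral_eval h.state 0)))
        rw [Term.eval_app_of (xs := fun _ => .num n) fun _ => (var_eval Z _).trans h.cnt, ← hy]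
        refine Eq.trans (congrArg (Z.fn _ 1) ?_) (hX.frame _ _ hm rfl ![] fun k => k.elim0)
        funext l
        rw [Subsingleton.elim l 0]
        rfl
      · refine Or.inr (Or.inr (Or.inr ⟨D, rfl, htr, ?_⟩))
        rw [(Rule.cond_eq_updates hst rfl).2 (by simp), trRule_updates hr hwf hq, hD]
        rfl
  · exact Or.inr (Or.inl hU)
  · have hp : (Y.A i).Poses x' ⟨e, Y.r (Y.callee i e), xs⟩ := ⟨he, X, hX.reaches, hev⟩
    exact Or.inl ⟨⟨Y.callee i e, xs⟩, ⟨e, rfl, hp⟩,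
      (Y.objective i e he).query x' hX.dom xs hp, hk, hU⟩

/-! ### Correctness -/

variable (Y) in
/-- `Z` is a state of the simulating algorithm as it occurs in the computation on `x`. -/
def Config (x : Fin (Y.r 0) → Elem α) (Z : Struct S α) : Prop :=
  ∃ n, Y.Inv x Z n ∧ (Y.Idle Z ∨ ∃ i x' X, Y.Running Z n i x' X)

theorem config_initial (h : Y.sim.IsInitial x Z) : Y.Inv x Z 0 ∧ Y.Idle Z := by
  have hb : ∀ {a : Aux N S} {m : Mark} {xs : Fin m.arity → Elem α}, Y.auxMark a = some m →
      (∀ k, a ≠ .inp k) → (∀ k, xs k ∈ Y.base) →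
      Z.fn (Y.sym a) m.arity xs = some m.kind.dflt := by
    intro a m xs hm ha hxs
    rw [h.other _ fun k hk => ha k (Y.sym_injective hk)]
    exact Y.blank_aux hm hxs
  refine ⟨⟨h.isState, hb (m := ⟨0, .dynamic, .numerical⟩) rfl (by simp) fun k => k.elim0,
    h.input, fun j xs hk => ?_, fun i f m hm hs n' _ xs hxs => ?_⟩,
    hb (m := ⟨0, .dynamic, .numerical⟩) rfl (by simp) fun k => k.elim0⟩
  -- The table starts empty: `known` is of general kind, so its default is nil and not true.
  · obtain ⟨m, hm, hma, -, hx, -⟩ := Z.fn_mem _ _ _ _ hk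
    rw [h.base] at hx
    have := hb (a := .known j) (m := ⟨Y.r j, .dynamic, .general⟩) rfl (by simp) hx
    rw [Known, this] at hk
    cases hk
  · refine hb (Y.auxMark_frame hm hs) (by simp) fun k => ?_
    refine Fin.cases ?_ (fun k => ?_) k
    · exact Y.not_atom_mem (by simp)
    · exact Y.base_subset i (hxs k)

/-- The result of the simulated step witnesses that the original step succeeds: contradictory
updates would remain contradictory after the shift, and the copy of a symbol permits the same values
as the symbol. -/
theorem shift_step {i : Fin N} {X : Struct S α} (hX : (Y.A i).IsState X)
    {D : Set (Loc S α × Elem α)} (hZ' : Y.sim.IsState Z')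
    (hD : (Y.A i).program.updates X = some D) (hu : Z.IsUpdate (Y.shift n i '' D) Z') :
    ∃ X', X.IsUpdate D X' := by
  have hwf := (Y.A i).program_wf
  rw [← hX.voc] at hwf
  have hc : ∀ p ∈ D, ∀ q ∈ D, p.1 = q.1 → p.2 = q.2 := by
    intro p hp q hq hpq
    refine hu.consistent (Y.shift n i p) ⟨p, hp, rfl⟩ (Y.shift n i q) ⟨q, hq, rfl⟩ ?_
    obtain ⟨l, y⟩ := p
    obtain ⟨l', y'⟩ := q
    obtain rfl : l = l' := hpq
    rfl
  have ha : ∀ p ∈ D, ∀ m, X.voc.mark p.1.sym = some m → m.kind.Allows p.2 := by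
    intro p hp m hm
    obtain ⟨⟨m', hm', hs, -⟩, -⟩ := hwf.updates_mem hD p hp
    obtain rfl := Option.some.inj (hm.symm.trans hm')
    rw [hX.voc] at hm
    obtain ⟨m₁, h1, -, h2, -⟩ := Z'.fn_mem _ _ _ _ (hu.content _ ⟨p, hp, rfl⟩)
    rw [hZ'.voc] at h1
    have h3 := (Y.mark_sym (.frame i p.1.sym)).trans (Y.auxMark_frame hm hs)
    obtain rfl := Option.some.inj (h1.symm.trans h3)
    exact h2
  obtain ⟨X', hX'⟩ := hwf.exists_step hD hc ha
  obtain ⟨E, hE, hX'⟩ := Rule.step_iff.1 hX'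
  obtain rfl := Option.some.inj (hD.symm.trans hE)
  exact ⟨X', hX'⟩

theorem Config.step (hx : x ∈ (Y.A 0).dom) (h : Y.Config x Z) (hs : Y.program.Step Z Z') :
    Y.Config x Z' := by
  obtain ⟨n, h, hi | ⟨i, x', X, hX⟩⟩ := h
  · have hZ' := h.state.step hs
    obtain ⟨U, hU, hu⟩ := Rule.step_iff.1 hs
    rcases h.idle_updates hx hi with ⟨y, -, -, h'⟩ | ⟨hk, h'⟩ <;>
      obtain rfl := Option.some.inj (hU.symm.trans h')
    · obtain ⟨h1, h2, -⟩ := h.out hZ' hi hu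
      exact ⟨n, h1, Or.inl h2⟩
    · obtain ⟨h1, ⟨X, h2⟩, -⟩ := h.call hZ' hx hk hu
      exact ⟨n + 1, h1, Or.inr ⟨0, x, X, h2⟩⟩
  · have hZ' := h.state.step hs
    obtain ⟨U, hU, hu⟩ := Rule.step_iff.1 hs
    rcases h.run_updates hX with ⟨q, -, hq, hk, h'⟩ | ⟨h', -⟩ | ⟨y, -, hy, h'⟩ | ⟨D, hD, -, h'⟩
    · obtain rfl := Option.some.inj (hU.symm.trans h')
      obtain ⟨h1, ⟨X, h2⟩, -⟩ := h.call hZ' hq hk hu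
      exact ⟨n + 1, h1, Or.inr ⟨q.1, q.2, X, h2⟩⟩
    · rw [hU] at h'
      cases h'
    · obtain rfl := Option.some.inj (hU.symm.trans h')
      obtain ⟨h1, h2, -⟩ := h.finish hZ' hy hu
      exact ⟨n, h1, Or.inl h2⟩
    · obtain rfl := Option.some.inj (hU.symm.trans h')
      obtain ⟨X', hX'⟩ := shift_step hX.reaches.isState hZ' hD hu
      obtain ⟨h1, h2, -⟩ := h.simulate hZ' hX hD hX' hu
      exact ⟨n, h1, Or.inr ⟨i, x', X', h2⟩⟩

/-- A call raises the run number, the end of a run resets the phase, and a step is simulated only if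
some update is nontrivial. So a fixed state is idle and has the recorded value as its output. -/
theorem Config.computes (hx : x ∈ (Y.A 0).dom) (h : Y.Config x Z) (hs : Y.program.Step Z Z)
    {y : Elem α} (hy : Z.fn (Y.sym .out) 0 ![] = some y) : (Y.A 0).Computes x y := by
  obtain ⟨U, hU, hc⟩ := Rule.step_self_iff.1 hs
  obtain ⟨n, h, hi | ⟨i, x', X, hX⟩⟩ := h
  · rcases h.idle_updates hx hi with ⟨z, -, hz, h'⟩ | ⟨hk, h'⟩ <;>
      obtain rfl := Option.some.inj (hU.symm.trans h')
    · have := hc _ rfl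
      obtain rfl := Option.some.inj (hy.symm.trans this)
      exact hz
    · have := hc _ (mem_callSet.2 (Or.inr (Or.inr (Or.inl rfl))))
      simpa using h.cnt.symm.trans this
  · exfalso
    rcases h.run_updates hX with ⟨q, -, hq, hk, h'⟩ | ⟨h', -⟩ | ⟨y, -, hy, h'⟩ | ⟨D, hD, hD', h'⟩
    · obtain rfl := Option.some.inj (hU.symm.trans h')
      have := hc _ (mem_callSet.2 (Or.inr (Or.inr (Or.inl rfl))))
      simpa using h.cnt.symm.trans this
    · rw [hU] at h'
      cases h'
    · obtain rfl := Option.some.inj (hU.symm.trans h')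
      have := hc _ (Or.inr (Or.inr rfl))
      simpa using hX.phase.symm.trans this
    · obtain rfl := Option.some.inj (hU.symm.trans h')
      refine hD' fun p hp => ?_
      have hwf := (Y.A i).program_wf
      rw [← hX.reaches.isState.voc] at hwf
      rw [← shift_content (h.represents hX) (hwf.updates_mem hD p hp)]
      exact hc _ ⟨p, hp, rfl⟩

theorem computes_of_sim {y : Elem α} (h : Y.sim.Computes x y) : (Y.A 0).Computes x y := by
  obtain ⟨hx, Z, ⟨Z₀, h₀, hZ⟩, hs, hy⟩ := h
  suffices Y.Config x Z from this.computes hx hs hy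
  clear hs hy
  induction hZ with
  | refl =>
    obtain ⟨h1, h2⟩ := config_initial h₀
    exact ⟨0, h1, Or.inl h2⟩
  | tail _ hs ih => exact ih.step hx hs

/-! ### Completeness: the simulation succeeds and terminates. -/

theorem exists_step (hZ : Y.sim.IsState Z) {D : Set (Loc S α × Elem α)}
    (hD : Y.program.updates Z = some D) (hc : ∀ p ∈ D, ∀ q ∈ D, p.1 = q.1 → p.2 = q.2)
    (ha : ∀ p ∈ D, ∀ m, Y.voc.mark p.1.sym = some m → m.kind.Allows p.2) :
    ∃ Z', Y.program.Step Z Z' ∧ Y.sim.IsState Z' ∧ Z.IsUpdate D Z' := by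
  have hwf := Y.program_wf
  have hv : Z.voc = Y.voc := hZ.voc
  rw [← hv] at hwf ha
  obtain ⟨Z', hZ'⟩ := hwf.exists_step hD hc ha
  obtain ⟨E, hE, hu⟩ := Rule.step_iff.1 hZ'
  obtain rfl := Option.some.inj (hD.symm.trans hE)
  exact ⟨Z', hZ', hZ.step hZ', hu⟩

theorem allows_of {a : Aux N S} {κ : Kind} {k : ℕ} {y : Elem α}
    (h : Y.auxMark a = some ⟨k, .dynamic, κ⟩) (hy : κ.Allows y) :
    ∀ m, Y.voc.mark (Y.sym a) = some m → m.kind.Allows y := by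
  intro m hm
  obtain rfl := Option.some.inj (hm.symm.trans ((Y.mark_sym a).trans h))
  exact hy

/-- Input variables may be relational or numerical; admissibility of `xs` guarantees that their
copies accept the values. -/
theorem Inv.exists_call (h : Y.Inv x Z n) {j : Fin N} {xs : Fin (Y.r j) → Elem α}
    (hxs : xs ∈ (Y.A j).dom) (hU : Y.program.updates Z = some (Y.callSet n j xs)) :
    ∃ Z', Y.program.Step Z Z' ∧ Y.sim.IsState Z' ∧ Z.IsUpdate (Y.callSet n j xs) Z' := by
  refine exists_step h.state hU (fun p hp q hq hpq => ?_) fun p hp => ?_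
  · have hs := congrArg Loc.sym hpq
    rcases mem_callSet.1 hp with ⟨k, rfl⟩ | ⟨k, rfl⟩ | rfl | rfl <;>
      rcases mem_callSet.1 hq with ⟨l, rfl⟩ | ⟨l, rfl⟩ | rfl | rfl <;>
      have hs := Y.sym_injective hs <;>
      simp only [Aux.arg.injEq, Aux.frame.injEq, true_and, reduceCtorEq] at hs ⊢
    · rw [Fin.ext hs]
    · rw [(Y.A j).input_injective hs]
  · rcases mem_callSet.1 hp with ⟨k, rfl⟩ | ⟨k, rfl⟩ | rfl | rfl
    · exact allows_of (Y.auxMark_arg k) trivial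
    · obtain ⟨κ, hm, hm'⟩ := Y.auxMark_input k
      exact allows_of hm' (((Y.A j).dom_mem xs hxs k).2 _ hm)
    · exact allows_of (κ := .numerical) rfl ⟨_, rfl⟩
    · exact allows_of (κ := .numerical) rfl ⟨_, rfl⟩

theorem Inv.exists_finish (h : Y.Inv x Z n) {i : Fin N} {x' : Fin (Y.r i) → Elem α}
    {y : Elem α} (hU : Y.program.updates Z = some (Y.finishSet i x' y)) :
    ∃ Z', Y.program.Step Z Z' ∧ Y.sim.IsState Z' ∧ Z.IsUpdate (Y.finishSet i x' y) Z' := by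
  refine exists_step h.state hU (fun p hp q hq hpq => ?_) fun p hp => ?_
  · have hs := congrArg Loc.sym hpq
    rcases hp with rfl | rfl | rfl <;> rcases hq with rfl | rfl | rfl <;>
      have hs := Y.sym_injective hs <;>
      simp only [reduceCtorEq] at hs ⊢
  · rcases hp with rfl | rfl | rfl
    · exact allows_of (κ := .general) rfl trivial
    · exact allows_of (κ := .general) rfl trivial
    · exact allows_of (κ := .numerical) rfl ⟨_, rfl⟩

theorem Inv.exists_simulate (h : Y.Inv x Z n) {i : Fin N} {x' : Fin (Y.r i) → Elem α}
    {X X' : Struct S α} (hX : Y.Running Z n i x' X) {D : Set (Loc S α × Elem α)}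
    (hD : (Y.A i).program.updates X = some D) (hX' : X.IsUpdate D X')
    (hU : Y.program.updates Z = some (Y.shift n i '' D)) :
    ∃ Z', Y.program.Step Z Z' ∧ Y.sim.IsState Z' ∧ Z.IsUpdate (Y.shift n i '' D) Z' := by
  have hst := hX.reaches.isState
  refine exists_step h.state hU ?_ ?_
  · rintro _ ⟨p, hp, rfl⟩ _ ⟨q, hq, rfl⟩ hpq
    exact hX'.consistent p hp q hq (shift_inj hpq).2
  · rintro _ ⟨p, hp, rfl⟩
    have hwf := (Y.A i).program_wf
    rw [← hst.voc] at hwf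
    obtain ⟨⟨m, hm, hs, -⟩, -⟩ := hwf.updates_mem hD p hp
    obtain ⟨m', hm', -, ha, -⟩ := X'.fn_mem _ _ _ _ (hX'.content p hp)
    rw [hX'.voc] at hm'
    obtain rfl := Option.some.inj (hm.symm.trans hm')
    rw [hst.voc] at hm
    exact allows_of (Y.auxMark_frame hm hs) ha

/-- Double induction: on accessibility in the call relation, and for a fixed run on the steps that
the simulated computation has left. A call passes to the outer induction and never returns to the
caller. The run that finally finishes was started for an unrecorded pair, which gives the new entry.
-/
theorem Inv.run_completes {Q : Set (Σ i, Fin (Y.r i) → Elem α)}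
    (hQ : ∀ p ∈ Q, ∃ y, (Y.A p.1).Computes p.2 y)
    (hQ' : ∀ p ∈ Q, ∀ q, Calls Y.A Y.callee p q → q ∈ Q) {p : Σ i, Fin (Y.r i) → Elem α}
    (hacc : Acc (fun q p => Calls Y.A Y.callee p q) p) (hp : p ∈ Q) {X : Struct S α}
    (h : Y.Inv x Z n) (hX : Y.Running Z n p.1 p.2 X) :
    ∃ Z' n', Relation.ReflTransGen Y.program.Step Z Z' ∧ Y.Inv x Z' n' ∧ Y.Idle Z' ∧
      (∀ j ys, Y.Known Z j ys → Y.Known Z' j ys) ∧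
      ∃ q ∈ Q, ¬ Y.Known Z q.1 q.2 ∧ Y.Known Z' q.1 q.2 := by
  induction hacc generalizing Z n X with
  | intro p _ ih =>
    obtain ⟨y, hy⟩ := hQ p hp
    obtain ⟨-, Xf, hXf, hsf, -⟩ := hy
    have hpath := hX.reaches.reflTransGen hXf hsf
    induction hpath using Relation.ReflTransGen.head_induction_on generalizing Z with
    | refl =>
      obtain ⟨E, hE, hE'⟩ := Rule.step_self_iff.1 hsf
      rcases h.run_updates hX with ⟨q, hc, hq, hk, h'⟩ | ⟨-, h'⟩ | ⟨z, -, hz, h'⟩ |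
        ⟨D, hD, hD', -⟩
      · obtain ⟨Z₁, hs, hst, hu⟩ := h.exists_call hq h'
        obtain ⟨h1, ⟨X₁, h2⟩, h3⟩ := h.call hst hq hk hu
        obtain ⟨Z', n', h4, h5, h6, h7, q', h8, h9, h10⟩ := ih q hc (hQ' p hp q hc) h1 h2
        exact ⟨Z', n', .head hs h4, h5, h6, fun j ys hj => h7 j ys ((h3 j ys).2 hj), q', h8,
          fun hk' => h9 ((h3 _ _).2 hk'), h10⟩
      · rw [hE] at h'
        cases h'
      · obtain ⟨Z₁, hs, hst, hu⟩ := h.exists_finish h'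
        obtain ⟨h1, h2, h3, h4⟩ := h.finish hst hz hu
        exact ⟨Z₁, n, .single hs, h1, h2, h4, p, hp, hX.unknown, h3⟩
      · obtain rfl := Option.some.inj (hE.symm.trans hD)
        exact (hD' hE').elim
    | @head X X' hstep _ ih' =>
      -- The third case is not excluded here: a path may begin with a step that leaves its state
      -- unchanged, and then the run ends at once.
      rcases h.run_updates hX with ⟨q, hc, hq, hk, h'⟩ | ⟨-, h'⟩ | ⟨z, hs, hz, h'⟩ |
        ⟨D, hD, hD', h'⟩
      · obtain ⟨Z₁, hs, hst, hu⟩ := h.exists_call hq h'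
        obtain ⟨h1, ⟨X₁, h2⟩, h3⟩ := h.call hst hq hk hu
        obtain ⟨Z', n', h4, h5, h6, h7, q', h8, h9, h10⟩ := ih q hc (hQ' p hp q hc) h1 h2
        exact ⟨Z', n', .head hs h4, h5, h6, fun j ys hj => h7 j ys ((h3 j ys).2 hj), q', h8,
          fun hk' => h9 ((h3 _ _).2 hk'), h10⟩
      · obtain ⟨E, hE, -⟩ := hstep
        rw [hE] at h'
        cases h'
      · obtain ⟨Z₁, hs, hst, hu⟩ := h.exists_finish h'
        obtain ⟨h1, h2, h3, h4⟩ := h.finish hst hz hu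
        exact ⟨Z₁, n, .single hs, h1, h2, h4, p, hp, hX.unknown, h3⟩
      · obtain ⟨E, hE, hX'⟩ := Rule.step_iff.1 hstep
        obtain rfl := Option.some.inj (hD.symm.trans hE)
        obtain ⟨Z₁, hs, hst, hu⟩ := h.exists_simulate hX hD hX' h'
        obtain ⟨h1, h2, h3⟩ := h.simulate hst hX hD hX' hu
        obtain ⟨Z', n', h4, h5, h6, h7, q', h8, h9, h10⟩ := ih' h1 h2
        exact ⟨Z', n', .head hs h4, h5, h6, fun j ys hj => h7 j ys ((h3 j ys).2 hj), q', h8,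
          fun hk' => h9 ((h3 _ _).2 hk'), h10⟩

/-- Every round from one idle state to the next keeps all table entries and adds one from the finite
set `Q`, so the number of missing entries decreases. -/
theorem Inv.reaches_known {Q : Set (Σ i, Fin (Y.r i) → Elem α)} (hfin : Q.Finite)
    (hQ : ∀ p ∈ Q, ∃ y, (Y.A p.1).Computes p.2 y)
    (hQ' : ∀ p ∈ Q, ∀ q, Calls Y.A Y.callee p q → q ∈ Q)
    (hacc : Acc (fun q p => Calls Y.A Y.callee p q) ⟨0, x⟩) (hx : ⟨0, x⟩ ∈ Q)
    (h : Y.Inv x Z n) (hi : Y.Idle Z) :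
    ∃ Z' n', Relation.ReflTransGen Y.program.Step Z Z' ∧ Y.Inv x Z' n' ∧ Y.Idle Z' ∧
      Y.Known Z' 0 x := by
  induction hk : {q ∈ Q | ¬ Y.Known Z q.1 q.2}.ncard using Nat.strong_induction_on
    generalizing Z n with
  | _ k ih =>
    have hd : x ∈ (Y.A 0).dom := by
      obtain ⟨y, hy⟩ := hQ _ hx
      exact hy.1
    rcases h.idle_updates hd hi with ⟨y, hy, -⟩ | ⟨hk', h'⟩
    · exact ⟨Z, n, .refl, h, hi, hy⟩
    · obtain ⟨Z₁, hs, hst, hu⟩ := h.exists_call hd h'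
      obtain ⟨h1, ⟨X, h2⟩, h3⟩ := h.call hst hd hk' hu
      obtain ⟨Z₂, n₂, h4, h5, h6, h7, q, h8, h9, h10⟩ :=
        Inv.run_completes (p := ⟨0, x⟩) hQ hQ' hacc hx h1 h2
      have hlt : {q ∈ Q | ¬ Y.Known Z₂ q.1 q.2}.ncard < k := by
        rw [← hk]
        refine Set.ncard_lt_ncard ?_ (hfin.subset fun q hq => hq.1)
        refine ⟨fun q hq => ⟨hq.1, fun hk => hq.2 (h7 _ _ ((h3 _ _).2 hk))⟩, fun hsub => ?_⟩
        exact (hsub ⟨h8, fun hk => h9 ((h3 _ _).2 hk)⟩).2 h10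
      obtain ⟨Z', n', h11, h12⟩ := ih _ hlt h5 h6 rfl
      exact ⟨Z', n', (Relation.ReflTransGen.head hs h4).trans h11, h12⟩

theorem sim_computes {y : Elem α} (h : (Y.A 0).Computes x y)
    (hacc : Acc (fun q p => Calls Y.A Y.callee p q) ⟨0, x⟩) :
    ∃ z, Y.sim.Computes x z := by
  have hdom : x ∈ Y.sim.dom := h.1
  obtain ⟨Z₀, h₀⟩ := Algorithm.exists_isInitial hdom
  obtain ⟨h1, h2⟩ := config_initial h₀
  let Q := {q | Relation.ReflTransGen (Calls Y.A Y.callee) ⟨0, x⟩ q}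
  have hQ : ∀ p ∈ Q, ∃ y, (Y.A p.1).Computes p.2 y := by
    intro p hp
    induction hp with
    | refl => exact ⟨y, h⟩
    | tail _ hc ih => exact hc.computes Y.objective ih
  obtain ⟨Z, n, h3, h4, h5, h6⟩ := Inv.reaches_known (Q := Q)
    (finite_callTree Y.objective hacc ⟨y, h⟩) hQ (fun p hp q hq => hp.tail hq) hacc .refl h1 h2
  obtain ⟨z, -, hz, h7⟩ | ⟨hk, -⟩ := h4.idle_updates h.1 h5
  swap
  · exact (hk h6).elim
  -- One more step writes the output; the step after it writes the same value again, by uniqueness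
  -- of the objective function, and so changes nothing.
  obtain ⟨Z₁, hs, hst, hu⟩ := exists_step h4.state h7
    (by rintro _ rfl _ rfl -; rfl)
    (by rintro _ rfl; exact allows_of (κ := .general) rfl trivial)
  obtain ⟨h8, h9, h10, h11⟩ := h4.out hst h5 hu
  have hk : Y.Known Z₁ 0 x := by
    rw [Known, h11 _ (by simp)]
    exact h6
  refine ⟨z, hdom, Z₁, ⟨Z₀, h₀, h3.tail hs⟩, ?_, h10⟩
  obtain ⟨z', -, hz', h12⟩ | ⟨hk', -⟩ := h8.idle_updates h.1 h9
  · obtain rfl := hz.unique hz'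
    refine Rule.step_self_iff.2 ⟨_, h12, ?_⟩
    rintro _ rfl
    exact h10
  · exact (hk' hk).elim

end System

end SeqASM

/-! ### The Pruning Theorem. -/

theorem theorem6p1 {S : Type*} [Infinite S] {α : Type*} {N : ℕ} [NeZero N] {r : Fin N → ℕ}
    (A : ∀ i, SeqASM.Algorithm S α (r i))
    (c : SeqASM.ArithNames S)
    (consistent : ∀ i j, (A i).datastructure.Consistent (A j).datastructure)
    (consistent_arith : ∀ i, (A i).datastructure.Consistent c.arith)
    (callee : Fin N → S → Fin N)
    (objective : ∀ i e, (A i).IsExtrinsic e → SeqASM.IsObjective (A i) e (A (callee i e)))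
    (recursion : ∀ x, (∃ y, (A 0).Computes x y) →
      Acc (fun q p => SeqASM.Calls A callee p q) ⟨0, x⟩) :
    ∃ B : SeqASM.Algorithm S α (r 0),
      B.IsNumerical ∧
      (∀ e, ¬ B.IsExtrinsic e) ∧
      SeqASM.IsUnion
        (fun o : Option (Fin N) => o.elim c.arith fun i => (A i).datastructure)
        B.datastructure ∧
      B.dom = (A 0).dom ∧
      ∀ x y, B.Computes x y ↔ (A 0).Computes x y := by
  obtain ⟨sym, hinj, hfresh⟩ := SeqASM.Aux.exists_embedding N
    (Set.finite_iUnion fun o : Option (Fin N) =>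
      (o.elim c.arith fun i => (A i).datastructure).voc.finite)
  let Y : SeqASM.System S α N :=
    { r, A, c, consistent, consistent_arith, callee, objective, sym
      sym_injective := hinj
      sym_fresh := fun a o => by
        by_contra h
        exact hfresh a (Set.mem_iUnion.2 ⟨o, h⟩) }
  refine ⟨Y.sim, Y.sim_isNumerical, Y.sim_not_isExtrinsic, Y.sim_datastructure, rfl,
    fun x y => ⟨fun h => Y.computes_of_sim h, fun h => ?_⟩⟩
  -- Completeness yields some output; soundness and uniqueness identify it with `y`.
  obtain ⟨z, hz⟩ := Y.sim_computes h (recursion x ⟨y, h⟩)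
  obtain rfl := h.unique (Y.computes_of_sim hz)
  exact hz
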